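/- Conventions. A represented space is a set $X$ with a surjective partial map $\delta_X:\subseteq\mathbb N^{\mathbb N}\to X$; $p$ is a name of $\delta_X(p)$. A multi-valued function $f:\subseteq X\rightrightarrows Y$ has domain $\mathrm{dom}(f)=\{x: f(x)\neq\emptyset\}$ and is computable if some computable partial function on $\mathbb N^{\mathbb N}$ maps every name of every $x\in\mathrm{dom}(f)$ to a name of some $y\in f(x)$. The composition $g\circ f$ has domain $\{x\in\mathrm{dom}(f): f(x)\subseteq\mathrm{dom}(g)\}$ and there $(g\circ f)(x)=\bigcup_{y\in f(x)}g(y)$. For $f:\subseteq X\rightrightarrows Y$ and $g:\subseteq W\rightrightarrows Z$ on represented spaces, $f\le_{\mathrm{sW}}g$ means that there are computable $K:\subseteq X\rightrightarrows W$ and $H:\subseteq Z\rightrightarrows Y$ with $\emptyset\neq HgK(x)\subseteq f(x)$ for all $x\in\mathrm{dom}(f)$; and $f\equiv_{\mathrm{sW}}g$ means $f\le_{\mathrm{sW}}g$ and $g\le_{\mathrm{sW}}f$. Spaces. $\mathrm{Int}$ is the space of sequences $\mathcal I=(I_n)_{n\in\mathbb N}$ of open intervals $I_n=(a_n,b_n)\subseteq\mathbb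 R$ with $a_n,b_n\in\mathbb Q$ (where $(a,b)=\emptyset$ if $b\le a$), given by listing the pairs of endpoints. The interval $[0,1]$ carries the Cauchy representation with respect to its rational points and the Lebesgue measure $\lambda$, and $\mathcal A_-([0,1])$ is the space of closed subsets $A\subseteq[0,1]$, where a name of $A$ lists rational open balls of $[0,1]$ (possibly empty) whose union is $[0,1]\setminus A$. The disjoint union $\bigsqcup_n X_n=\{(n,x):n\in\mathbb N,\ x\in X_n\}$ of represented spaces is represented by giving $n$ followed by a name of $x$, and the coproduct of $f_n:\subseteq X_n\rightrightarrows Y_n$ is the multi-valued function $\bigsqcup_n f_n:\subseteq\bigsqcup_n X_n\rightrightarrows\bigsqcup_n Y_n$, $(n,x)\mapsto\{n\}\times f_n(x)$. Problems. The Additive Covering Theorem is the multi-valued function $\mathsf{ACT}:\subseteq\mathrm{Int}\rightrightarrows[0,1]$, $\mathcal I\mapsto[0,1]\setminus\bigcup_n I_n$, whose domain is the set of all $\mathcal I=(I_n)_n$ with $I_i\cap I_j\neq\emptyset$ for some $i\neq j$ and $\sum_{n=0}^\infty\lambda(I_n)<1$. For $\varepsilon>0$ let $\mathsf P_{>\varepsilon}\mathsf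 C_{[0,1]}:\subseteq\mathcal A_-([0,1])\rightrightarrows[0,1]$, $A\mapsto A$, with domain $\{A:\lambda(A)>\varepsilon\}$, and let $*\text{-}\mathsf{WWKL}:=\bigsqcup_{n=0}^\infty\mathsf P_{>2^{-n}}\mathsf C_{[0,1]}$. Theorem. $\mathsf{ACT}\equiv_{\mathrm{sW}}*\text{-}\mathsf{WWKL}$. -/

import Mathlib

open Set MeasureTheory TopologicalSpace
open scoped ENNReal

namespace Weihrauch

/-! ### Computable functions on Baire space -/

/-- The initial segment `p 0, …, p (n - 1)` of a point of Baire space. -/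
def initSeg (p : ℕ → ℕ) (n : ℕ) : List ℕ := (List.range n).map p

/-- `q` is the infinite sequence approximated by the words `h (p 0 … p (n - 1))`, `n ∈ ℕ`:
each of these words is an initial segment of `q`, and their lengths are unbounded. -/
def IsLimitAt (h : List ℕ → List ℕ) (p q : ℕ → ℕ) : Prop :=
  (∀ n, h (initSeg p n) = initSeg q (h (initSeg p n)).length) ∧
    ∀ m, ∃ n, m ≤ (h (initSeg p n)).length

/-- A partial function `F :⊆ ℕ^ℕ → ℕ^ℕ` is computable if on its domain it is the limit of a
computable word function that is monotone for the prefix order. -/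
def ComputableFunctional (F : (ℕ → ℕ) →. (ℕ → ℕ)) : Prop :=
  ∃ h : List ℕ → List ℕ, Computable h ∧ (∀ u v, u <+: v → h u <+: h v) ∧
    ∀ p, ∀ q ∈ F p, IsLimitAt h p q

/-! ### Represented spaces and multi-valued functions -/

/-- A represented space: a type with a surjective partial map from Baire space onto it. -/
class RepresentedSpace (X : Type) where
  rep : (ℕ → ℕ) →. X
  rep_surjective : ∀ x, ∃ p, x ∈ rep p

/-- Partial multi-valued functions `f :⊆ X ⇉ Y`; the points outside the domain are those at which
the set of values is empty. -/
abbrev MultiMap (X Y : Type) : Type := X → Set Y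

/-- The domain of a partial multi-valued function. -/
def MultiMap.dom {X Y : Type} (f : MultiMap X Y) : Set X := {x | (f x).Nonempty}

/-- Composition of multi-valued functions: `x` is in the domain of `g ∘ f` if and only if
`x ∈ dom f` and `f x ⊆ dom g`; then `(g ∘ f) x` is the union of all `g y` with `y ∈ f x`. -/
def MultiMap.comp {X Y Z : Type} (g : MultiMap Y Z) (f : MultiMap X Y) : MultiMap X Z :=
  fun x => {z | f x ⊆ g.dom ∧ ∃ y ∈ f x, z ∈ g y}

/-- A multi-valued function on represented spaces is computable if it has a computable realizer:
a function that maps each name of each `x ∈ dom f` to a name of some `y ∈ f x`. -/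
def MultiMap.IsComputable {X Y : Type} [RepresentedSpace X] [RepresentedSpace Y]
    (f : MultiMap X Y) : Prop :=
  ∃ F : (ℕ → ℕ) →. (ℕ → ℕ), ComputableFunctional F ∧
    ∀ p, ∀ x ∈ RepresentedSpace.rep (X := X) p, x ∈ f.dom →
      ∃ q ∈ F p, ∃ y ∈ RepresentedSpace.rep (X := Y) q, y ∈ f x

/-- Strong Weihrauch reducibility: there are computable multi-valued `K`, `H` with
`∅ ≠ H (g (K x)) ⊆ f x` for all `x ∈ dom f`. -/
def StrongReducible {X Y W Z : Type} [RepresentedSpace X] [RepresentedSpace Y]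
    [RepresentedSpace W] [RepresentedSpace Z] (f : MultiMap X Y) (g : MultiMap W Z) : Prop :=
  ∃ (K : MultiMap X W) (H : MultiMap Z Y), K.IsComputable ∧ H.IsComputable ∧
    ∀ x ∈ f.dom, (H.comp (g.comp K) x).Nonempty ∧ H.comp (g.comp K) x ⊆ f x

/-- Strong Weihrauch equivalence. -/
def StrongEquivalent {X Y W Z : Type} [RepresentedSpace X] [RepresentedSpace Y]
    [RepresentedSpace W] [RepresentedSpace Z] (f : MultiMap X Y) (g : MultiMap W Z) : Prop :=
  StrongReducible f g ∧ StrongReducible g f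

/-! ### Coproducts -/

/-- The disjoint union of a sequence of represented spaces: a name of `⟨n, x⟩` is `n` followed by
a name of `x`. -/
instance sigmaRepresented (X : ℕ → Type) [∀ n, RepresentedSpace (X n)] :
    RepresentedSpace (Σ n, X n) where
  rep p := (RepresentedSpace.rep (X := X (p 0)) (fun i => p (i + 1))).map (fun x => ⟨p 0, x⟩)
  rep_surjective := by
    rintro ⟨n, x⟩
    obtain ⟨p, hp⟩ := RepresentedSpace.rep_surjective x
    exact ⟨fun i => Nat.casesOn i n p, Part.mem_map _ hp⟩

/-- The coproduct of a sequence of multi-valued functions: `⟨n, x⟩ ↦ {n} × f_n(x)`. -/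
def coproduct {X Y : ℕ → Type} (f : ∀ n, MultiMap (X n) (Y n)) :
    MultiMap (Σ n, X n) (Σ n, Y n) :=
  fun a => Sigma.mk a.1 '' f a.1 a.2

/-! ### Rational numbers and metric spaces -/

/-- The standard numbering `⟨⟨i, j⟩, k⟩ ↦ (i - j) / (k + 1)` of the rational numbers. -/
def ratNum (m : ℕ) : ℚ :=
  ((m.unpair.1.unpair.1 : ℚ) - (m.unpair.1.unpair.2 : ℚ)) / ((m.unpair.2 : ℚ) + 1)

theorem ratNum_surjective : Function.Surjective ratNum := by
  intro q
  refine ⟨Nat.pair (Nat.pair q.num.toNat (-q.num).toNat) (q.den - 1), ?_⟩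
  have h1 : ((q.num.toNat : ℤ) - ((-q.num).toNat : ℤ)) = q.num := by omega
  have h2 : ((q.num.toNat : ℚ) - ((-q.num).toNat : ℚ)) = (q.num : ℚ) := by exact_mod_cast h1
  have h3 : (((q.den - 1 : ℕ) : ℚ) + 1) = (q.den : ℚ) := by
    have := q.den_pos
    exact_mod_cast (by omega : q.den - 1 + 1 = q.den)
  simp only [ratNum, Nat.unpair_pair]
  rw [h2, h3, Rat.num_div_den]

/-- A metric space with a chosen dense sequence. -/
class DenseSequence (X : Type) [MetricSpace X] where
  pt : ℕ → X
  dense : DenseRange pt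

theorem cauchyName_unique {X : Type} [MetricSpace X] {u : ℕ → X} {x y : X}
    (hx : ∀ n, dist (u n) x ≤ (2⁻¹ : ℝ) ^ n) (hy : ∀ n, dist (u n) y ≤ (2⁻¹ : ℝ) ^ n) : x = y := by
  have h0 : Filter.Tendsto (fun n : ℕ => (2⁻¹ : ℝ) ^ n) Filter.atTop (nhds 0) :=
    tendsto_pow_atTop_nhds_zero_of_lt_one (by norm_num) (by norm_num)
  exact tendsto_nhds_unique
    (tendsto_iff_dist_tendsto_zero.2 (squeeze_zero (fun _ => dist_nonneg) hx h0))
    (tendsto_iff_dist_tendsto_zero.2 (squeeze_zero (fun _ => dist_nonneg) hy h0))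

/-- The Cauchy representation: `p` is a name of `x` if the `n`-th point of the dense sequence that
`p` lists has distance at most `2⁻ⁿ` from `x`, for all `n`. -/
noncomputable def cauchyRep (X : Type) [MetricSpace X] [DenseSequence X] : (ℕ → ℕ) →. X :=
  fun p => ⟨∃ x : X, ∀ n, dist (DenseSequence.pt (p n)) x ≤ (2⁻¹ : ℝ) ^ n, fun h => h.choose⟩

theorem mem_cauchyRep {X : Type} [MetricSpace X] [DenseSequence X] (p : ℕ → ℕ) (x : X) :
    x ∈ cauchyRep X p ↔ ∀ n, dist (DenseSequence.pt (p n)) x ≤ (2⁻¹ : ℝ) ^ n := by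
  constructor
  · rintro ⟨h, rfl⟩
    exact h.choose_spec
  · intro hp
    have h : ∃ x : X, ∀ n, dist (DenseSequence.pt (p n)) x ≤ (2⁻¹ : ℝ) ^ n := ⟨x, hp⟩
    exact ⟨h, cauchyName_unique h.choose_spec hp⟩

noncomputable instance cauchyRepresented (X : Type) [MetricSpace X] [DenseSequence X] :
    RepresentedSpace X where
  rep := cauchyRep X
  rep_surjective := by
    intro x
    have h : ∀ n : ℕ, ∃ m, dist (DenseSequence.pt m) x ≤ (2⁻¹ : ℝ) ^ n := by
      intro n
      obtain ⟨m, hm⟩ := (DenseSequence.dense (X := X)).exists_dist_lt x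
        (show (0 : ℝ) < (2⁻¹ : ℝ) ^ n by positivity)
      exact ⟨m, by rw [dist_comm]; exact hm.le⟩
    choose p hp using h
    exact ⟨p, (mem_cauchyRep p x).2 hp⟩

/-- The open rational ball with code `m`; it is empty if the radius is not positive. -/
def ratBall (X : Type) [MetricSpace X] [DenseSequence X] (m : ℕ) : Set X :=
  Metric.ball (DenseSequence.pt m.unpair.1) (ratNum m.unpair.2 : ℝ)

/-- Closed subsets with respect to negative information: `p` is a name of the complement of the
union of the rational open balls that `p` lists. -/
instance closedsRepresented (X : Type) [MetricSpace X] [DenseSequence X] :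
    RepresentedSpace (Closeds X) where
  rep p := Part.some ⟨(⋃ i, ratBall X (p i))ᶜ,
    (isOpen_iUnion fun _ => Metric.isOpen_ball).isClosed_compl⟩
  rep_surjective := by
    classical
    intro A
    obtain ⟨m₀, hm₀⟩ := ratNum_surjective 0
    refine ⟨fun i => if ratBall X i ⊆ (A : Set X)ᶜ then i else Nat.pair 0 m₀, ?_⟩
    rw [Part.mem_some_iff]
    apply SetLike.coe_injective
    change (A : Set X) = (⋃ i, ratBall X _)ᶜ
    rw [eq_comm, compl_eq_comm, eq_comm]
    apply Subset.antisymm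
    · refine iUnion_subset fun i => ?_
      split_ifs with hi
      · exact hi
      · simp [ratBall, hm₀]
    · intro x hx
      obtain ⟨ε, hε, hball⟩ := Metric.isOpen_iff.1 A.isClosed.isOpen_compl x hx
      obtain ⟨m, hm⟩ := (DenseSequence.dense (X := X)).exists_dist_lt x (half_pos hε)
      obtain ⟨q, hq1, hq2⟩ := exists_rat_btwn hm
      obtain ⟨k, rfl⟩ := ratNum_surjective q
      have hsub : ratBall X (Nat.pair m k) ⊆ (A : Set X)ᶜ := by
        intro y hy
        apply hball
        simp only [ratBall, Nat.unpair_pair, Metric.mem_ball] at hy ⊢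
        have := dist_triangle y (DenseSequence.pt m) x
        rw [dist_comm (DenseSequence.pt m) x] at this
        linarith
      refine mem_iUnion.2 ⟨Nat.pair m k, ?_⟩
      rw [if_pos hsub]
      simpa [ratBall] using hq1

/-- The dense sequence of the rational points of `[0,1]`: the standard numbering of the rational
numbers, projected to `[0,1]`. -/
noncomputable instance : DenseSequence unitInterval where
  pt m := projIcc (0 : ℝ) 1 zero_le_one (ratNum m : ℝ)
  dense := by
    have h : DenseRange fun m => (ratNum m : ℝ) :=
      (Rat.denseRange_cast (𝕜 := ℝ)).comp ratNum_surjective.denseRange Rat.continuous_coe_real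
    exact (projIcc_surjective (zero_le_one (α := ℝ))).denseRange.comp h continuous_projIcc

/-! ### Positive choice -/

/-- `P_{>ε}C_X`: given a closed set `A` of measure greater than `ε`, find a point of `A`. -/
def positiveChoice (X : Type) [MetricSpace X] [MeasureSpace X] (ε : ℝ≥0∞) :
    MultiMap (Closeds X) X :=
  fun A => {x | ε < volume (A : Set X) ∧ x ∈ A}

theorem dom_positiveChoice (X : Type) [MetricSpace X] [MeasureSpace X] (ε : ℝ≥0∞) :
    (positiveChoice X ε).dom = {A : Closeds X | ε < volume (A : Set X)} := by
  ext A
  constructor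
  · rintro ⟨x, hx⟩
    exact hx.1
  · intro h
    obtain ⟨x, hx⟩ := nonempty_of_measure_ne_zero (ne_bot_of_gt h)
    exact ⟨x, h, hx⟩

/-- `*-WWKL`, the coproduct of the problems `P_{>2⁻ⁿ}C_{[0,1]}` with respect to Lebesgue
measure. -/
def starWWKL : MultiMap (Σ _ : ℕ, Closeds unitInterval) (Σ _ : ℕ, unitInterval) :=
  coproduct fun n => positiveChoice unitInterval ((2⁻¹ : ℝ≥0∞) ^ n)

/-! ### The Additive Covering Theorem -/

/-- Sequences of open intervals with rational endpoints, given by the sequences of the left and the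
right endpoints. -/
structure IntervalSeq : Type where
  left : ℕ → ℚ
  right : ℕ → ℚ

/-- The `n`-th interval `(a, b) ⊆ ℝ` of the sequence; it is empty if `b ≤ a`. -/
def IntervalSeq.interval (I : IntervalSeq) (n : ℕ) : Set ℝ := Ioo (I.left n : ℝ) (I.right n : ℝ)

/-- The canonical representation of `(ℚ²)^ℕ`: the `n`-th value of a name is a code of the pair of
endpoints of the `n`-th interval. -/
instance intervalSeqRepresented : RepresentedSpace IntervalSeq where
  rep p := Part.some ⟨fun n => ratNum (p n).unpair.1, fun n => ratNum (p n).unpair.2⟩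
  rep_surjective := by
    intro I
    choose c hc using ratNum_surjective
    refine ⟨fun n => Nat.pair (c (I.left n)) (c (I.right n)), ?_⟩
    simp [hc]

/-- Some two members of the sequence with different indices intersect. -/
def IntervalSeq.NonDisjoint (I : IntervalSeq) : Prop :=
  ∃ i j, i ≠ j ∧ (I.interval i ∩ I.interval j).Nonempty

/-- The problem `ACT`: given a non-disjoint sequence of rational intervals of total length less
than `1`, find a point of `[0,1]` that it does not cover. -/
def ACT : MultiMap IntervalSeq unitInterval :=
  fun I => {x | (I.NonDisjoint ∧ ∑' n, volume (I.interval n) < 1) ∧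
    (x : ℝ) ∉ ⋃ n, I.interval n}

theorem dom_ACT : ACT.dom = {I | I.NonDisjoint ∧ ∑' n, volume (I.interval n) < 1} := by
  ext I
  constructor
  · rintro ⟨x, hx⟩
    exact hx.1
  · intro h
    by_contra hne
    have hcov : Icc (0 : ℝ) 1 ⊆ ⋃ n, I.interval n := by
      intro x hx
      by_contra hx'
      exact hne ⟨⟨x, hx⟩, h, hx'⟩
    have h1 := (measure_mono hcov).trans (measure_iUnion_le (μ := volume) I.interval)
    rw [Real.volume_Icc] at h1
    norm_num at h1
    exact absurd h.2 (not_lt.2 h1)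

end Weihrauch

namespace Weihrauch

/-! ### Initial segments -/

/-! Both reductions trade an overlap of intervals for a quantitative lower bound on the measure left
uncovered.

From `ACT` to `*-WWKL`: if two members with different indices meet, they overlap in positive length,
and an exhaustive search finds such a pair and an `n` with overlap above `2⁻ⁿ`. The sum of the
lengths counts this overlap twice, so the measure of the union plus the overlap is at most a sum
below `1`. Hence the uncovered part of `[0,1]` has measure above `2⁻ⁿ`, and it is a legitimate
instance for the threshold `n`. The point returned solves `ACT` once the label `n` is dropped.

From `*-WWKL` to `ACT`: let `U` be the open complement of a closed set of measure above `δ = 2⁻ⁿ`. A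
strong reduction must recover the label `n` from the solution alone. So an affine copy of the
problem is placed in `[L, 2L]` with `L = 2^(-2n-1)`, and the rest of `[0,1]` is covered by two outer
intervals. These windows are separated for different `n`, hence an uncovered point determines `n`
computably. A further interval is added only to create an overlap.

The listed balls of `U` may overlap heavily, so their lengths cannot simply be summed. They are
replaced by pairwise disjoint dyadic cells: ball `k` receives the cells of level `n + k + 5` that
touch it and do not lie in a cell used for an earlier ball. The level grows with `k`, so the
overhang sums to at most `3δ/16`. Enlarging the cells slightly makes the cover open. The slack `δ`
pays for the overhang, the enlargement and the outer intervals (`tsum_volume_coverSeq_lt_one`),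
while every point of `U` remains covered (`exists_fresh`). -/

@[simp] theorem length_initSeg (p : ℕ → ℕ) (n : ℕ) : (initSeg p n).length = n := by
  simp [initSeg]

theorem getElem?_initSeg {p : ℕ → ℕ} {n i : ℕ} (h : i < n) : (initSeg p n)[i]? = some (p i) := by
  simp [initSeg, h]

theorem take_initSeg (p : ℕ → ℕ) (n t : ℕ) : (initSeg p n).take t = initSeg p (min t n) := by
  simp [initSeg, ← List.map_take, List.take_range]

theorem initSeg_prefix (p : ℕ → ℕ) {m n : ℕ} (h : m ≤ n) : initSeg p m <+: initSeg p n := by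
  rw [List.prefix_iff_eq_take, take_initSeg, length_initSeg, min_eq_left h]

theorem eq_initSeg_of_prefix {l : List ℕ} {q : ℕ → ℕ} {n : ℕ} (h : l <+: initSeg q n) :
    l = initSeg q l.length := by
  have h1 := List.prefix_iff_eq_take.1 h
  have h2 := h.length_le
  rw [length_initSeg] at h2
  rwa [take_initSeg, min_eq_left h2] at h1

/-! ### Functionals given digit by digit -/

/-- The values of the longest initial segment of a list that consists of defined values. -/
def definedPrefix (l : List (Option ℕ)) : List ℕ :=
  (l.takeWhile Option.isSome).filterMap id

/-- Adding information to a table of digits can only prolong its initial block of defined digits.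
This yields the monotonicity of the word function and its agreement with the limit. -/
theorem definedPrefix_prefix : ∀ {l m : List (Option ℕ)},
    (∀ i a : ℕ, l[i]? = some (some a) → m[i]? = some (some a)) →
      definedPrefix l <+: definedPrefix m
  | [], _, _ => by simp [definedPrefix]
  | none :: _, _, _ => by simp [definedPrefix]
  | some a :: l, [], h => by simpa using h 0 a
  | some a :: l, b :: m, h => by
    obtain rfl : b = some a := by simpa using h 0 a
    have := definedPrefix_prefix (l := l) (m := m) fun i c hc => by
      simpa using h (i + 1) c (by simpa using hc)
    simpa [definedPrefix] using this

theorem definedPrefix_initSeg (q : ℕ → ℕ) (n : ℕ) :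
    definedPrefix ((List.range n).map fun i => some (q i)) = initSeg q n := by
  have h : ((List.range n).map fun i => some (q i)).takeWhile Option.isSome =
      (List.range n).map fun i => some (q i) := by
    rw [List.takeWhile_eq_self_iff]
    simp
  rw [definedPrefix, h, List.filterMap_map, initSeg]
  simp

/-- The first value that `g` assigns to the `i`-th digit on the prefixes of `u`. -/
def firstDigit (g : List ℕ → ℕ → Option ℕ) (u : List ℕ) (i : ℕ) : Option ℕ :=
  ((List.range (u.length + 1)).filterMap fun t => g (u.take t) i).head?

/-- The procedure may give different answers on different prefixes. Committing to the earliest one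
makes the answer stable under extension of the input. -/
theorem firstDigit_mono (g : List ℕ → ℕ → Option ℕ) {u v : List ℕ} (h : u <+: v) {i a : ℕ}
    (ha : firstDigit g u i = some a) : firstDigit g v i = some a := by
  have h1 : (List.range (u.length + 1)).filterMap (fun t => g (u.take t) i) =
      (List.range (u.length + 1)).filterMap (fun t => g (v.take t) i) := by
    refine List.filterMap_congr fun t ht => ?_
    rw [List.mem_range] at ht
    obtain ⟨w, rfl⟩ := h
    rw [List.take_append_of_le_length (by omega)]
  have h2 : List.range (u.length + 1) <+: List.range (v.length + 1) := by
    rw [List.prefix_iff_eq_take, List.take_range]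
    have := h.length_le
    simp [this]
  obtain ⟨w, hw⟩ := h2.filterMap fun t => g (v.take t) i
  rw [firstDigit, h1] at ha
  rw [firstDigit, ← hw, List.head?_append, ha]
  rfl

theorem exists_of_firstDigit {g : List ℕ → ℕ → Option ℕ} {p : ℕ → ℕ} {n i a : ℕ}
    (h : firstDigit g (initSeg p n) i = some a) : ∃ t, g (initSeg p t) i = some a := by
  have h1 := List.mem_of_mem_head? h
  obtain ⟨t, -, ht⟩ := List.mem_filterMap.1 h1
  rw [take_initSeg] at ht
  exact ⟨_, ht⟩

theorem exists_firstDigit {g : List ℕ → ℕ → Option ℕ} {p : ℕ → ℕ} {t i a : ℕ}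
    (h : g (initSeg p t) i = some a) : ∃ b, firstDigit g (initSeg p t) i = some b := by
  rw [← Option.ne_none_iff_exists', firstDigit, Ne, List.head?_eq_none_iff]
  refine List.ne_nil_of_mem (a := a) (List.mem_filterMap.2 ⟨t, by simp, ?_⟩)
  rw [take_initSeg, min_self, h]

theorem primrec_firstDigit {g : List ℕ → ℕ → Option ℕ} (hg : Primrec₂ g) :
    Primrec₂ (firstDigit g) := by
  refine Primrec.list_head?.comp (Primrec.listFilterMap
    (Primrec.list_range.comp (Primrec.succ.comp (Primrec.list_length.comp Primrec.fst))) ?_)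
  exact hg.comp (Primrec.list_take.comp Primrec.snd (Primrec.fst.comp Primrec.fst))
    (Primrec.snd.comp Primrec.fst)

/-- A primitive recursive procedure that computes digits from finite prefixes gives a computable
functional that is defined wherever every digit is eventually found. -/
theorem exists_computableFunctional {g : List ℕ → ℕ → Option ℕ} (hg : Primrec₂ g) :
    ∃ F : (ℕ → ℕ) →. (ℕ → ℕ), ComputableFunctional F ∧
      ∀ p, (∀ i, ∃ t a, g (initSeg p t) i = some a) →
        ∃ q ∈ F p, ∀ i, ∃ t, g (initSeg p t) i = some (q i) := by
  refine ⟨fun p => ⟨∀ i, ∃ a n, firstDigit g (initSeg p n) i = some a, fun h i => (h i).choose⟩,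
    ⟨fun u => definedPrefix ((List.range u.length).map (firstDigit g u)), ?_, ?_, ?_⟩, ?_⟩
  · refine Primrec.to_comp (Primrec.listFilterMap ?_ Primrec.snd)
    exact (Primrec.list_takeWhile Primrec.option_isSome).comp (Primrec.list_map
      (Primrec.list_range.comp Primrec.list_length) (primrec_firstDigit hg))
  · intro u v h
    refine definedPrefix_prefix fun i a hi => ?_
    have hl := h.length_le
    simp only [List.getElem?_map, Option.map_eq_some_iff, List.getElem?_eq_some_iff,
      List.length_range, List.getElem_range] at hi ⊢
    obtain ⟨j, ⟨h1, rfl⟩, h2⟩ := hi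
    exact ⟨i, ⟨by omega, rfl⟩, firstDigit_mono g h h2⟩
  · rintro p q ⟨hd, rfl⟩
    have hq : ∀ i, ∃ n, firstDigit g (initSeg p n) i = some ((hd i).choose) :=
      fun i => (hd i).choose_spec
    choose N hN using hq
    set q : ℕ → ℕ := fun i => (hd i).choose with hqdef
    -- Any two prefixes of `p` have a common extension, on which both recorded digits survive.
    have huniq : ∀ n i a, firstDigit g (initSeg p n) i = some a → a = q i := by
      intro n i a ha
      have h1 := firstDigit_mono g (initSeg_prefix p (le_max_left n (N i))) ha
      have h2 := firstDigit_mono g (initSeg_prefix p (le_max_right n (N i))) (hN i)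
      exact Option.some_injective _ (h1.symm.trans h2)
    constructor
    · intro n
      refine eq_initSeg_of_prefix (n := n) ?_
      change definedPrefix _ <+: initSeg q n
      rw [← definedPrefix_initSeg q n]
      refine definedPrefix_prefix fun i a hi => ?_
      simp only [length_initSeg, List.getElem?_map, Option.map_eq_some_iff,
        List.getElem?_eq_some_iff, List.length_range, List.getElem_range] at hi ⊢
      obtain ⟨j, ⟨h1, rfl⟩, h2⟩ := hi
      exact ⟨i, ⟨h1, rfl⟩, by rw [huniq _ _ _ h2]⟩
    · intro m
      set n := max m ((Finset.range m).sup N)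
      refine ⟨n, ?_⟩
      have : initSeg q m <+:
          definedPrefix ((List.range (initSeg p n).length).map (firstDigit g (initSeg p n))) := by
        rw [← definedPrefix_initSeg q m]
        refine definedPrefix_prefix fun i a hi => ?_
        simp only [length_initSeg, List.getElem?_map, Option.map_eq_some_iff,
          List.getElem?_eq_some_iff, List.length_range, List.getElem_range] at hi ⊢
        obtain ⟨j, ⟨h1, rfl⟩, h2⟩ := hi
        refine ⟨i, ⟨h1.trans_le (le_max_left _ _), rfl⟩, ?_⟩
        rw [← h2]
        exact firstDigit_mono g (initSeg_prefix p
          ((Finset.le_sup (Finset.mem_range.2 h1)).trans (le_max_right _ _))) (hN i)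
      simpa using this.length_le
  · intro p hp
    have hd : ∀ i, ∃ a n, firstDigit g (initSeg p n) i = some a := by
      intro i
      obtain ⟨t, a, h⟩ := hp i
      obtain ⟨b, hb⟩ := exists_firstDigit h
      exact ⟨b, t, hb⟩
    refine ⟨_, ⟨hd, rfl⟩, fun i => ?_⟩
    exact exists_of_firstDigit (hd i).choose_spec.choose_spec

/-! ### Strong reducibility by realizers -/

/-- It suffices to argue with names: the multi-valued `K` and `H` collect what the functionals
produce over all names of a point. Since the functionals and representations are single-valued, the
hypothesis controls every value so collected. -/
theorem StrongReducible.of_functionals {X Y W Z : Type} [RepresentedSpace X] [RepresentedSpace Y]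
    [RepresentedSpace W] [RepresentedSpace Z] {f : MultiMap X Y} {g : MultiMap W Z}
    {K H : (ℕ → ℕ) →. (ℕ → ℕ)} (hK : ComputableFunctional K) (hH : ComputableFunctional H)
    (h : ∀ x ∈ f.dom, ∀ p, x ∈ RepresentedSpace.rep (X := X) p →
      ∃ q ∈ K p, ∃ w ∈ RepresentedSpace.rep (X := W) q, w ∈ g.dom ∧
        ∀ z ∈ g w, ∀ r, z ∈ RepresentedSpace.rep (X := Z) r →
          ∃ s ∈ H r, ∃ y ∈ RepresentedSpace.rep (X := Y) s, y ∈ f x) :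
    StrongReducible f g := by
  -- The guard in the second map confines its domain to points all of whose names are translated
  -- successfully, as a realizer has to handle each of them.
  refine ⟨fun x => {w | x ∈ f.dom ∧ ∃ p, x ∈ RepresentedSpace.rep (X := X) p ∧
      ∃ q ∈ K p, w ∈ RepresentedSpace.rep (X := W) q},
    fun z => {y | (∀ r, z ∈ RepresentedSpace.rep (X := Z) r →
        ∃ s ∈ H r, ∃ y, y ∈ RepresentedSpace.rep (X := Y) s) ∧
      ∃ r, z ∈ RepresentedSpace.rep (X := Z) r ∧
        ∃ s ∈ H r, y ∈ RepresentedSpace.rep (X := Y) s}, ⟨K, hK, ?_⟩, ⟨H, hH, ?_⟩, ?_⟩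
  · rintro p x hx ⟨-, hd, -⟩
    obtain ⟨q, hq, w, hw, -⟩ := h x hd p hx
    exact ⟨q, hq, w, hw, hd, p, hx, q, hq, hw⟩
  · rintro r z hz ⟨-, hd, -⟩
    obtain ⟨s, hs, y, hy⟩ := hd r hz
    exact ⟨s, hs, y, hy, hd, r, hz, s, hs, hy⟩
  · intro x hd
    obtain ⟨p, hp⟩ := RepresentedSpace.rep_surjective x
    have key : ∀ p, x ∈ RepresentedSpace.rep (X := X) p → ∀ q ∈ K p,
        ∀ w ∈ RepresentedSpace.rep (X := W) q, w ∈ g.dom ∧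
        ∀ z ∈ g w, ∀ r, z ∈ RepresentedSpace.rep (X := Z) r →
          ∃ s ∈ H r, ∃ y ∈ RepresentedSpace.rep (X := Y) s, y ∈ f x := by
      intro p hp q hq w hw
      obtain ⟨q', hq', w', hw', h'⟩ := h x hd p hp
      obtain rfl := Part.mem_unique hq hq'
      obtain rfl := Part.mem_unique hw hw'
      exact h'
    constructor
    · obtain ⟨q, hq, w, hw, ⟨z, hz⟩, h1⟩ := h x hd p hp
      obtain ⟨r, hr⟩ := RepresentedSpace.rep_surjective z
      obtain ⟨s, hs, y, hy, -⟩ := h1 z hz r hr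
      refine ⟨y, ?_, z, ⟨?_, w, ⟨hd, p, hp, q, hq, hw⟩, hz⟩, ?_, r, hr, s, hs, hy⟩
      · rintro z' ⟨-, w', ⟨-, p', hp', q', hq', hw'⟩, hz'⟩
        obtain ⟨r', hr'⟩ := RepresentedSpace.rep_surjective z'
        have h2 := (key p' hp' q' hq' w' hw').2 z' hz'
        obtain ⟨s', hs', y', hy', -⟩ := h2 r' hr'
        refine ⟨y', fun r'' hr'' => ?_, r', hr', s', hs', hy'⟩
        obtain ⟨s', hs', y', hy', -⟩ := h2 r'' hr''
        exact ⟨s', hs', y', hy'⟩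
      · rintro w' ⟨-, p', hp', q', hq', hw'⟩
        exact (key p' hp' q' hq' w' hw').1
      · intro r' hr'
        obtain ⟨s', hs', y', hy', -⟩ := h1 z hz r' hr'
        exact ⟨s', hs', y', hy'⟩
    · rintro y ⟨-, z, ⟨-, w, ⟨-, p, hp, q, hq, hw⟩, hz⟩, -, r, hr, s, hs, hy⟩
      obtain ⟨s', hs', y', hy', hf⟩ := (key p hp q hq w hw).2 z hz r hr
      obtain rfl := Part.mem_unique hs hs'
      obtain rfl := Part.mem_unique hy hy'
      exact hf

/-! ### Primitive recursive rational functions -/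

/-- A rational-valued function that has a primitive recursive realizer with respect to the standard
numbering of the rational numbers. -/
def PrimrecRat {α : Type*} [Primcodable α] (f : α → ℚ) : Prop :=
  ∃ c : α → ℕ, Primrec c ∧ ∀ a, ratNum (c a) = f a

section PrimrecRat

variable {α : Type*} [Primcodable α]

theorem primrec_two_pow {f : α → ℕ} (hf : Primrec f) : Primrec fun a => 2 ^ f a :=
  (Primrec₂.unpaired'.1 Nat.Primrec.pow).comp (Primrec.const 2) hf

namespace PrimrecRat

/-- Splitting a code into two numerator parts and a shifted denominator lets arithmetic and order be
handled by cross multiplication of natural numbers. -/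
theorem iff_div {f : α → ℚ} : PrimrecRat f ↔ ∃ x y z : α → ℕ, Primrec x ∧ Primrec y ∧ Primrec z ∧
    ∀ a, f a = ((x a : ℚ) - y a) / ((z a : ℚ) + 1) := by
  constructor
  · rintro ⟨c, hc, h⟩
    have h1 := Primrec.unpair.comp hc
    have h2 := Primrec.unpair.comp (Primrec.fst.comp h1)
    exact ⟨_, _, _, Primrec.fst.comp h2, Primrec.snd.comp h2, Primrec.snd.comp h1,
      fun a => (h a).symm⟩
  · rintro ⟨x, y, z, hx, hy, hz, h⟩
    refine ⟨_, Primrec₂.natPair.comp (Primrec₂.natPair.comp hx hy) hz, fun a => ?_⟩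
    simp [ratNum, h]

theorem of_eq {f g : α → ℚ} (hf : PrimrecRat f) (h : ∀ a, f a = g a) : PrimrecRat g :=
  (funext h : f = g) ▸ hf

theorem ratNum {f : α → ℕ} (hf : Primrec f) : PrimrecRat fun a => ratNum (f a) :=
  ⟨f, hf, fun _ => rfl⟩

theorem const (q : ℚ) : PrimrecRat fun _ : α => q := by
  obtain ⟨m, hm⟩ := ratNum_surjective q
  exact ⟨_, Primrec.const m, fun _ => hm⟩

theorem natCast {f : α → ℕ} (hf : Primrec f) : PrimrecRat fun a => (f a : ℚ) :=
  iff_div.2 ⟨f, _, _, hf, Primrec.const 0, Primrec.const 0, fun a => by simp⟩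

theorem add {f g : α → ℚ} (hf : PrimrecRat f) (hg : PrimrecRat g) :
    PrimrecRat fun a => f a + g a := by
  obtain ⟨x, y, z, hx, hy, hz, h⟩ := iff_div.1 hf
  obtain ⟨x', y', z', hx', hy', hz', h'⟩ := iff_div.1 hg
  have hs := Primrec.succ.comp hz
  have hs' := Primrec.succ.comp hz'
  refine iff_div.2 ⟨_, _, _,
    Primrec.nat_add.comp (Primrec.nat_mul.comp hx hs') (Primrec.nat_mul.comp hx' hs),
    Primrec.nat_add.comp (Primrec.nat_mul.comp hy hs') (Primrec.nat_mul.comp hy' hs),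
    Primrec.nat_add.comp (Primrec.nat_mul.comp hz hs') hz', fun a => ?_⟩
  rw [h, h']
  push_cast
  have h1 : (z a : ℚ) + 1 ≠ 0 := by positivity
  have h2 : (z' a : ℚ) + 1 ≠ 0 := by positivity
  have h3 : (z a : ℚ) * (z' a + 1) + z' a + 1 = (z a + 1) * (z' a + 1) := by ring
  rw [h3]
  field_simp
  ring

theorem mul {f g : α → ℚ} (hf : PrimrecRat f) (hg : PrimrecRat g) :
    PrimrecRat fun a => f a * g a := by
  obtain ⟨x, y, z, hx, hy, hz, h⟩ := iff_div.1 hf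
  obtain ⟨x', y', z', hx', hy', hz', h'⟩ := iff_div.1 hg
  have hs' := Primrec.succ.comp hz'
  refine iff_div.2 ⟨_, _, _,
    Primrec.nat_add.comp (Primrec.nat_mul.comp hx hx') (Primrec.nat_mul.comp hy hy'),
    Primrec.nat_add.comp (Primrec.nat_mul.comp hx hy') (Primrec.nat_mul.comp hy hx'),
    Primrec.nat_add.comp (Primrec.nat_mul.comp hz hs') hz', fun a => ?_⟩
  rw [h, h']
  push_cast
  have h3 : (z a : ℚ) * (z' a + 1) + z' a + 1 = (z a + 1) * (z' a + 1) := by ring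
  rw [h3, div_mul_div_comm]
  ring

theorem sub {f g : α → ℚ} (hf : PrimrecRat f) (hg : PrimrecRat g) :
    PrimrecRat fun a => f a - g a :=
  (hf.add ((const (-1)).mul hg)).of_eq fun a => by ring

theorem inv_two_pow {f : α → ℕ} (hf : Primrec f) : PrimrecRat fun a => (2⁻¹ : ℚ) ^ f a := by
  refine iff_div.2 ⟨_, _, _, Primrec.const 1, Primrec.const 0,
    Primrec.pred.comp (primrec_two_pow hf), fun a => ?_⟩
  have h : (((2 ^ f a).pred : ℕ) : ℚ) + 1 = 2 ^ f a := by
    have h1 : (2 ^ f a).pred + 1 = 2 ^ f a := Nat.succ_pred_eq_of_pos (by positivity)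
    exact_mod_cast h1
  rw [h]
  simp

theorem ite {f g : α → ℚ} {c : α → Prop} [DecidablePred c] (hc : PrimrecPred c)
    (hf : PrimrecRat f) (hg : PrimrecRat g) : PrimrecRat fun a => if c a then f a else g a := by
  obtain ⟨x, hx, h⟩ := hf
  obtain ⟨y, hy, h'⟩ := hg
  refine ⟨_, Primrec.ite hc hx hy, fun a => ?_⟩
  by_cases ha : c a <;> simp [ha, h, h']

theorem lt {f g : α → ℚ} (hf : PrimrecRat f) (hg : PrimrecRat g) :
    PrimrecPred fun a => f a < g a := by
  obtain ⟨x, y, z, hx, hy, hz, h⟩ := iff_div.1 hf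
  obtain ⟨x', y', z', hx', hy', hz', h'⟩ := iff_div.1 hg
  have hs := Primrec.succ.comp hz
  have hs' := Primrec.succ.comp hz'
  refine (Primrec.nat_lt.comp
    (Primrec.nat_add.comp (Primrec.nat_mul.comp hx hs') (Primrec.nat_mul.comp hy' hs))
    (Primrec.nat_add.comp (Primrec.nat_mul.comp hx' hs) (Primrec.nat_mul.comp hy hs'))).of_eq
    fun a => ?_
  rw [h, h', div_lt_div_iff₀ (by positivity) (by positivity), ← Nat.cast_lt (α := ℚ)]
  push_cast
  constructor <;> intro h <;> linarith

theorem le {f g : α → ℚ} (hf : PrimrecRat f) (hg : PrimrecRat g) :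
    PrimrecPred fun a => f a ≤ g a :=
  (hg.lt hf).not.of_eq fun _ => not_lt

end PrimrecRat

end PrimrecRat

/-! ### Rational points and rational balls of the unit interval -/

/-- The rational number in `[0,1]` that is closest to `q`. -/
def clampRat (q : ℚ) : ℚ := if q < 0 then 0 else if 1 < q then 1 else q

theorem clampRat_of_mem {q : ℚ} (h0 : 0 ≤ q) (h1 : q ≤ 1) : clampRat q = q := by
  rw [clampRat, if_neg h0.not_gt, if_neg h1.not_gt]

theorem coe_pt_unitInterval (m : ℕ) :
    ((DenseSequence.pt m : unitInterval) : ℝ) = (clampRat (ratNum m) : ℝ) := by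
  change max (0 : ℝ) (min 1 (ratNum m : ℝ)) = _
  rw [clampRat]
  split_ifs with h h'
  · have : (ratNum m : ℝ) < 0 := by exact_mod_cast h
    rw [min_eq_right (by linarith), max_eq_left this.le]
    simp
  · have : (1 : ℝ) < ratNum m := by exact_mod_cast h'
    rw [min_eq_left this.le]
    simp
  · have h1 : (0 : ℝ) ≤ ratNum m := by exact_mod_cast not_lt.1 h
    have h2 : (ratNum m : ℝ) ≤ 1 := by exact_mod_cast not_lt.1 h'
    rw [min_eq_right h2, max_eq_right h1]

theorem PrimrecRat.clampRat {α : Type*} [Primcodable α] {f : α → ℚ} (hf : PrimrecRat f) :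
    PrimrecRat fun a => clampRat (f a) :=
  .ite (hf.lt (.const 0)) (.const 0) (.ite ((PrimrecRat.const 1).lt hf) (.const 1) hf)

theorem mem_ratBall_unitInterval {m : ℕ} {x : unitInterval} :
    x ∈ ratBall unitInterval m ↔
      |(x : ℝ) - (clampRat (ratNum m.unpair.1) : ℝ)| < (ratNum m.unpair.2 : ℝ) := by
  rw [ratBall, Metric.mem_ball, Subtype.dist_eq, Real.dist_eq, coe_pt_unitInterval]

/-- The trace of a rational interval on `[0,1]` is a rational ball of `[0,1]`, uniformly. -/
theorem exists_primrec_ratBall_eq_interval : ∃ c : ℕ → ℕ, Primrec c ∧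
    ∀ (e : ℕ) (x : unitInterval), x ∈ ratBall unitInterval (c e) ↔
      (x : ℝ) ∈ Ioo (ratNum e.unpair.1 : ℝ) (ratNum e.unpair.2 : ℝ) := by
  have ha : PrimrecRat fun e : ℕ => ratNum e.unpair.1 :=
    .ratNum (Primrec.fst.comp Primrec.unpair)
  have hb : PrimrecRat fun e : ℕ => ratNum e.unpair.2 :=
    .ratNum (Primrec.snd.comp Primrec.unpair)
  have h0 := ha.lt (.const 0)
  have h1 := (PrimrecRat.const 1).lt hb
  -- Centers must lie in `[0,1]`. An interval that sticks out on one side becomes a ball around that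
  -- endpoint, one that sticks out on both sides becomes the ball of radius `1` around `1/2`, and
  -- otherwise the midpoint serves. Empty traces get a nonpositive radius.
  obtain ⟨u, hu, hu'⟩ : PrimrecRat fun e : ℕ => if ratNum e.unpair.1 < 0 then
      (if 1 < ratNum e.unpair.2 then 2⁻¹ else 0) else
      (if 1 < ratNum e.unpair.2 then 1 else
        (ratNum e.unpair.1 + ratNum e.unpair.2) * 2⁻¹) :=
    .ite h0 (.ite h1 (.const _) (.const _)) (.ite h1 (.const _) ((ha.add hb).mul (.const _)))
  obtain ⟨v, hv, hv'⟩ : PrimrecRat fun e : ℕ => if ratNum e.unpair.1 < 0 then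
      (if 1 < ratNum e.unpair.2 then 1 else ratNum e.unpair.2) else
      (if 1 < ratNum e.unpair.2 then 1 - ratNum e.unpair.1 else
        (ratNum e.unpair.2 - ratNum e.unpair.1) * 2⁻¹) :=
    .ite h0 (.ite h1 (.const _) hb)
      (.ite h1 ((PrimrecRat.const _).sub ha) ((hb.sub ha).mul (.const _)))
  refine ⟨fun e => Nat.pair (u e) (v e), Primrec₂.natPair.comp hu hv, fun e x => ?_⟩
  rw [mem_ratBall_unitInterval, Nat.unpair_pair, hu', hv']
  dsimp only
  generalize ratNum e.unpair.1 = a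
  generalize ratNum e.unpair.2 = b
  obtain ⟨x, hx0, hx1⟩ := x
  rw [mem_Ioo, abs_lt]
  dsimp only
  split_ifs with h0 h1 h1
  · have h2 : (a : ℝ) < 0 := by exact_mod_cast h0
    have h3 : (1 : ℝ) < b := by exact_mod_cast h1
    rw [clampRat_of_mem (by norm_num) (by norm_num)]
    push_cast
    constructor <;> intro _ <;> constructor <;> linarith
  · have h2 : (a : ℝ) < 0 := by exact_mod_cast h0
    rw [clampRat_of_mem (by norm_num) (by norm_num)]
    push_cast
    constructor <;> rintro ⟨_, _⟩ <;> constructor <;> linarith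
  · have h3 : (1 : ℝ) < b := by exact_mod_cast h1
    rw [clampRat_of_mem (by norm_num) (by norm_num)]
    push_cast
    constructor <;> rintro ⟨_, _⟩ <;> constructor <;> linarith
  · have h2 : (0 : ℝ) ≤ a := by exact_mod_cast not_lt.1 h0
    have h3 : (b : ℝ) ≤ 1 := by exact_mod_cast not_lt.1 h1
    by_cases hab : b ≤ a
    · have h4 : (b : ℝ) ≤ a := by exact_mod_cast hab
      push_cast
      constructor <;> rintro ⟨_, _⟩ <;> linarith
    · have h0' := not_lt.1 h0
      have h1' := not_lt.1 h1
      have h4 := (not_le.1 hab).le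
      rw [clampRat_of_mem (by linarith) (by linarith)]
      push_cast
      constructor <;> rintro ⟨_, _⟩ <;> constructor <;> linarith

/-! ### `ACT` is reducible to `*-WWKL` -/

/-- Replacing `s i` by `s i \ s j` does not change the union, but lowers the sum of the measures by
the measure of the intersection. -/
theorem measure_iUnion_add_inter_le {α : Type*} [MeasurableSpace α] (μ : Measure α)
    {s : ℕ → Set α} (hs : ∀ n, MeasurableSet (s n)) {i j : ℕ} (hij : i ≠ j) :
    μ (⋃ n, s n) + μ (s i ∩ s j) ≤ ∑' n, μ (s n) := by
  set t : ℕ → Set α := Function.update s i (s i \ s j) with ht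
  have hsub : (⋃ n, s n) ⊆ ⋃ n, t n := by
    refine iUnion_subset fun n x hx => ?_
    rw [mem_iUnion]
    by_cases hj : x ∈ s j
    · exact ⟨j, by rwa [ht, Function.update_of_ne hij.symm]⟩
    · refine ⟨n, ?_⟩
      by_cases hn : n = i
      · subst hn
        rw [ht, Function.update_self]
        exact ⟨hx, hj⟩
      · rwa [ht, Function.update_of_ne hn]
  have h1 : μ (⋃ n, s n) ≤ μ (s i \ s j) + ∑' n, ite (n = i) 0 (μ (s n)) := by
    refine ((measure_mono hsub).trans (measure_iUnion_le t)).trans_eq ?_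
    have h2 : ∀ n, ite (n = i) 0 (μ (t n)) = ite (n = i) 0 (μ (s n)) := fun n => by
      by_cases hn : n = i
      · rw [if_pos hn, if_pos hn]
      · rw [if_neg hn, if_neg hn, ht, Function.update_of_ne hn]
    have h3 : t i = s i \ s j := Function.update_self ..
    have h4 := ENNReal.tsum_eq_add_tsum_ite (f := fun n => μ (t n)) i
    rw [h4, h3]
    refine congrArg _ (tsum_congr fun n => ?_)
    rw [← h2]
    congr
  have h5 := ENNReal.tsum_eq_add_tsum_ite (f := fun n => μ (s n)) i
  have h6 := measure_inter_add_sdiff (μ := μ) (s i) (hs j)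
  rw [h5, ← h6, add_comm (μ (s i ∩ s j)), add_right_comm]
  refine add_le_add_left (h1.trans_eq (congrArg _ (tsum_congr fun n => ?_))) _
  congr

theorem one_le_volume_add {A : Set unitInterval} {U : Set ℝ}
    (h : ∀ x : unitInterval, (x : ℝ) ∉ U → x ∈ A) : 1 ≤ volume A + volume U := by
  have h1 : Icc (0 : ℝ) 1 ⊆ (Subtype.val '' A) ∪ U := by
    intro x hx
    by_cases hU : x ∈ U
    · exact Or.inr hU
    · exact Or.inl ⟨⟨x, hx⟩, h ⟨x, hx⟩ hU, rfl⟩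
  have h2 := (measure_mono h1).trans (measure_union_le (μ := volume) _ _)
  rwa [Real.volume_Icc, sub_zero, ENNReal.ofReal_one, ← unitInterval.volume_apply] at h2

theorem ofReal_inv_two_pow (n : ℕ) : ENNReal.ofReal ((2⁻¹ : ℝ) ^ n) = (2⁻¹ : ℝ≥0∞) ^ n := by
  rw [ENNReal.ofReal_pow (by norm_num), ENNReal.ofReal_inv_of_pos (by norm_num)]
  simp

/-- If two of the intervals of a family of total length less than `1` overlap in an interval of
length at least `ε`, then they leave more than `ε` of `[0,1]` uncovered. -/
theorem lt_volume_of_overlap {I : IntervalSeq} (hI : ∑' n, volume (I.interval n) < 1)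
    {i j : ℕ} (hij : i ≠ j) {ε : ℝ}
    (h : ENNReal.ofReal ε ≤ volume (I.interval i ∩ I.interval j)) {A : Set unitInterval}
    (hA : ∀ x : unitInterval, (x : ℝ) ∉ ⋃ n, I.interval n → x ∈ A) :
    ENNReal.ofReal ε < volume A := by
  have h1 := one_le_volume_add hA
  have h2 := measure_iUnion_add_inter_le volume (s := I.interval)
    (fun n => measurableSet_Ioo) hij
  have h3 := h2.trans_lt hI
  have h4 : volume (⋃ n, I.interval n) ≠ ∞ :=
    ((le_self_add.trans_lt h3).trans ENNReal.one_lt_top).ne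
  have h5 : volume (⋃ n, I.interval n) + ENNReal.ofReal ε <
      volume (⋃ n, I.interval n) + volume A :=
    calc _ ≤ _ := by gcongr
      _ < 1 := h3
      _ ≤ _ := h1
      _ = _ := add_comm _ _
  exact (ENNReal.add_lt_add_iff_left h4).1 h5

/-- A common point lies strictly between either left endpoint and either right endpoint, so all four
differences are positive. Being strict rational inequalities, they can be found by search. -/
theorem exists_pow_lt_of_overlap {I : IntervalSeq} {i j : ℕ}
    (h : (I.interval i ∩ I.interval j).Nonempty) : ∃ n : ℕ,
      (2⁻¹ : ℚ) ^ n < I.right i - I.left i ∧ (2⁻¹ : ℚ) ^ n < I.right i - I.left j ∧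
      (2⁻¹ : ℚ) ^ n < I.right j - I.left i ∧ (2⁻¹ : ℚ) ^ n < I.right j - I.left j := by
  obtain ⟨x, ⟨h1, h2⟩, h3, h4⟩ := h
  have key : ∀ {a b : ℚ}, (a : ℝ) < x → x < b → 0 < b - a := fun ha hb => by
    have := ha.trans hb
    rw [sub_pos]
    exact_mod_cast this
  obtain ⟨n, hn⟩ := exists_pow_lt_of_lt_one
    (lt_min (lt_min (key h1 h2) (key h3 h2)) (lt_min (key h1 h4) (key h3 h4)))
    (show (2⁻¹ : ℚ) < 1 by norm_num)
  simp only [lt_min_iff] at hn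
  exact ⟨n, hn.1.1, hn.1.2, hn.2.1, hn.2.2⟩

/-- The intersection has the smaller right and the larger left endpoint, so its length is governed
by one of the four differences. -/
theorem le_volume_of_pow_lt {I : IntervalSeq} {i j n : ℕ}
    (h1 : (2⁻¹ : ℚ) ^ n < I.right i - I.left i) (h2 : (2⁻¹ : ℚ) ^ n < I.right i - I.left j)
    (h3 : (2⁻¹ : ℚ) ^ n < I.right j - I.left i) (h4 : (2⁻¹ : ℚ) ^ n < I.right j - I.left j) :
    ENNReal.ofReal ((2⁻¹ : ℝ) ^ n) ≤ volume (I.interval i ∩ I.interval j) := by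
  rw [IntervalSeq.interval, IntervalSeq.interval, Ioo_inter_Ioo, Real.volume_Ioo]
  apply ENNReal.ofReal_le_ofReal
  have key : ∀ {a b : ℚ}, (2⁻¹ : ℚ) ^ n < b - a → (a : ℝ) ≤ b - (2⁻¹ : ℝ) ^ n := fun {a b} h => by
    have : (((2⁻¹ : ℚ) ^ n : ℚ) : ℝ) < ((b - a : ℚ) : ℝ) := by exact_mod_cast h
    push_cast at this
    linarith
  have e1 := key h1
  have e2 := key h2
  have e3 := key h3
  have e4 := key h4
  rcases min_choice (I.right i : ℝ) (I.right j) with h | h <;>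
    rcases max_choice (I.left i : ℝ) (I.left j) with h' | h' <;> rw [h, h'] <;> linarith

/-- The digits of a name of an instance of `*-WWKL`, from a name of an instance of `ACT`. -/
def overlapDigits (c : ℕ → ℕ) (u : List ℕ) : ℕ → Option ℕ
  | 0 =>
    let w := (u.length - 1).unpair
    let v := w.2.unpair
    let a := fun i => ratNum (u.getD i 0).unpair.1
    let b := fun i => ratNum (u.getD i 0).unpair.2
    if 0 < u.length ∧ w.1 ≠ v.1 ∧ (2⁻¹ : ℚ) ^ v.2 < b w.1 - a w.1 ∧
      (2⁻¹ : ℚ) ^ v.2 < b w.1 - a v.1 ∧ (2⁻¹ : ℚ) ^ v.2 < b v.1 - a w.1 ∧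
      (2⁻¹ : ℚ) ^ v.2 < b v.1 - a v.1 then some v.2 else none
  | i + 1 => u[i]?.map c

theorem primrec_overlapDigits {c : ℕ → ℕ} (hc : Primrec c) : Primrec₂ (overlapDigits c) := by
  have hw : Primrec fun u : List ℕ => (u.length - 1).unpair :=
    Primrec.unpair.comp (Primrec.pred.comp Primrec.list_length)
  have hv : Primrec fun u : List ℕ => (u.length - 1).unpair.2.unpair :=
    Primrec.unpair.comp (Primrec.snd.comp hw)
  have ha : ∀ {f : List ℕ → ℕ}, Primrec f →
      PrimrecRat fun u : List ℕ => ratNum (u.getD (f u) 0).unpair.1 := fun hf =>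
    .ratNum (Primrec.fst.comp (Primrec.unpair.comp ((Primrec.list_getD 0).comp Primrec.id hf)))
  have hb : ∀ {f : List ℕ → ℕ}, Primrec f →
      PrimrecRat fun u : List ℕ => ratNum (u.getD (f u) 0).unpair.2 := fun hf =>
    .ratNum (Primrec.snd.comp (Primrec.unpair.comp ((Primrec.list_getD 0).comp Primrec.id hf)))
  have hi := Primrec.fst.comp hw
  have hj := Primrec.fst.comp hv
  have hn := Primrec.snd.comp hv
  have he := PrimrecRat.inv_two_pow hn
  have h0 : Primrec fun u => overlapDigits c u 0 := by
    refine Primrec.ite ?_ (Primrec.option_some.comp hn) (Primrec.const none)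
    refine PrimrecPred.and (Primrec.nat_lt.comp (Primrec.const 0) Primrec.list_length) ?_
    refine PrimrecPred.and (Primrec.eq.comp hi hj).not ?_
    refine PrimrecPred.and (he.lt ((hb hi).sub (ha hi))) ?_
    refine PrimrecPred.and (he.lt ((hb hi).sub (ha hj))) ?_
    exact PrimrecPred.and (he.lt ((hb hj).sub (ha hi))) (he.lt ((hb hj).sub (ha hj)))
  have h1 : Primrec fun x : (List ℕ × ℕ) × ℕ => x.1.1[x.2]?.map c :=
    Primrec.option_map (Primrec.list_getElem?.comp (Primrec.fst.comp Primrec.fst) Primrec.snd)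
      (hc.comp Primrec.snd)
  refine (Primrec.nat_casesOn Primrec.snd (h0.comp Primrec.fst) h1.to₂).of_eq ?_
  rintro ⟨u, _ | i⟩ <;> rfl

theorem getD_initSeg {p : ℕ → ℕ} {n i : ℕ} (h : i < n) : (initSeg p n).getD i 0 = p i := by
  rw [List.getD_eq_getElem?_getD, getElem?_initSeg h, Option.getD_some]

/-- The length of the prefix, less one, codes the candidate `(i, j, n)`. Pairing dominates its
components, so the prefix is long enough to contain both intervals. -/
theorem overlapDigits_zero_eq_some {c : ℕ → ℕ} {p : ℕ → ℕ} {n t : ℕ} :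
    overlapDigits c (initSeg p t) 0 = some n ↔ ∃ i j, t = Nat.pair i (Nat.pair j n) + 1 ∧ i ≠ j ∧
      (2⁻¹ : ℚ) ^ n < ratNum (p i).unpair.2 - ratNum (p i).unpair.1 ∧
      (2⁻¹ : ℚ) ^ n < ratNum (p i).unpair.2 - ratNum (p j).unpair.1 ∧
      (2⁻¹ : ℚ) ^ n < ratNum (p j).unpair.2 - ratNum (p i).unpair.1 ∧
      (2⁻¹ : ℚ) ^ n < ratNum (p j).unpair.2 - ratNum (p j).unpair.1 := by
  have key : ∀ i j n, (overlapDigits c (initSeg p (Nat.pair i (Nat.pair j n) + 1)) 0 =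
      if i ≠ j ∧ (2⁻¹ : ℚ) ^ n < ratNum (p i).unpair.2 - ratNum (p i).unpair.1 ∧
      (2⁻¹ : ℚ) ^ n < ratNum (p i).unpair.2 - ratNum (p j).unpair.1 ∧
      (2⁻¹ : ℚ) ^ n < ratNum (p j).unpair.2 - ratNum (p i).unpair.1 ∧
      (2⁻¹ : ℚ) ^ n < ratNum (p j).unpair.2 - ratNum (p j).unpair.1 then some n else none) := by
    intro i j n
    have hi : i < Nat.pair i (Nat.pair j n) + 1 := Nat.lt_succ_of_le (Nat.left_le_pair _ _)
    have hj : j < Nat.pair i (Nat.pair j n) + 1 :=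
      Nat.lt_succ_of_le ((Nat.left_le_pair _ _).trans (Nat.right_le_pair _ _))
    simp only [overlapDigits, length_initSeg, Nat.add_sub_cancel, Nat.unpair_pair,
      getD_initSeg hi, getD_initSeg hj, Nat.succ_pos, true_and]
  constructor
  · intro h
    obtain ⟨w, rfl⟩ : ∃ w, t = w + 1 := by
      refine Nat.exists_eq_succ_of_ne_zero ?_
      rintro rfl
      simp [overlapDigits] at h
    obtain ⟨i, j, m, rfl⟩ : ∃ i j m, w = Nat.pair i (Nat.pair j m) :=
      ⟨w.unpair.1, w.unpair.2.unpair.1, w.unpair.2.unpair.2, by simp⟩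
    rw [key, ite_eq_iff] at h
    simp only [reduceCtorEq, and_false, or_false, Option.some.injEq] at h
    obtain ⟨h, rfl⟩ := h
    exact ⟨i, j, rfl, h⟩
  · rintro ⟨i, j, rfl, h⟩
    rw [key, if_pos h]

theorem ACT_strongReducible_starWWKL : StrongReducible ACT starWWKL := by
  obtain ⟨c, hc, hball⟩ := exists_primrec_ratBall_eq_interval
  obtain ⟨K, hK, hK'⟩ := exists_computableFunctional (primrec_overlapDigits hc)
  -- The backward functional merely drops the label `n` in front of the name of the point.
  obtain ⟨H, hH, hH'⟩ := exists_computableFunctional (g := fun u i => u[i + 1]?)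
    (Primrec.list_getElem?.comp Primrec.fst (Primrec.succ.comp Primrec.snd))
  refine .of_functionals hK hH fun I hI p hp => ?_
  rw [dom_ACT] at hI
  obtain ⟨⟨i, j, hij, hne⟩, hsum⟩ := hI
  obtain rfl := Part.mem_some_iff.1 hp
  set I : IntervalSeq := ⟨fun n => ratNum (p n).unpair.1, fun n => ratNum (p n).unpair.2⟩ with hIdef
  obtain ⟨q, hq, hq'⟩ := hK' p (by
    rintro (_ | k)
    · obtain ⟨n, hn⟩ := exists_pow_lt_of_overlap hne
      exact ⟨_, n, overlapDigits_zero_eq_some.2 ⟨i, j, rfl, hij, hn⟩⟩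
    · exact ⟨k + 1, c (p k), by rw [overlapDigits, getElem?_initSeg k.lt_succ_self]; rfl⟩)
  obtain ⟨t, ht⟩ := hq' 0
  obtain ⟨i', j', -, hij', h1, h2, h3, h4⟩ := overlapDigits_zero_eq_some.1 ht
  have hq1 : ∀ k, q (k + 1) = c (p k) := by
    intro k
    obtain ⟨t, ht⟩ := hq' (k + 1)
    simp only [overlapDigits, Option.map_eq_some_iff] at ht
    obtain ⟨a, ha, hac⟩ := ht
    have hk : k < t := by
      by_contra hk
      rw [List.getElem?_eq_none (by simpa using hk)] at ha
      simp at ha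
    rw [getElem?_initSeg hk, Option.some_inj] at ha
    rw [← hac, ← ha]
  let A : Closeds unitInterval := ⟨(⋃ k, ratBall unitInterval (q (k + 1)))ᶜ,
    (isOpen_iUnion fun _ => Metric.isOpen_ball).isClosed_compl⟩
  have hA : ∀ x : unitInterval, x ∈ A ↔ (x : ℝ) ∉ ⋃ n, I.interval n := by
    intro x
    change x ∉ ⋃ k, ratBall unitInterval (q (k + 1)) ↔ _
    simp only [mem_iUnion, hq1, hball]
    rfl
  have hvol : (2⁻¹ : ℝ≥0∞) ^ q 0 < volume (A : Set unitInterval) := by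
    rw [← ofReal_inv_two_pow]
    exact lt_volume_of_overlap hsum hij' (le_volume_of_pow_lt (I := I) h1 h2 h3 h4)
      fun x hx => (hA x).2 hx
  have hdom : A ∈ (positiveChoice unitInterval ((2⁻¹ : ℝ≥0∞) ^ q 0)).dom := by
    rw [dom_positiveChoice]
    exact hvol
  refine ⟨q, hq, ⟨q 0, A⟩, Part.mem_map _ (Part.mem_some _), hdom.image _, ?_⟩
  rintro _ ⟨x, ⟨-, hx⟩, rfl⟩ r hr
  obtain ⟨x', hx', hxe⟩ := (Part.mem_map_iff _).1 hr
  obtain rfl : x' = x := by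
    simpa using congrArg (fun z : Σ _ : ℕ, unitInterval => z.2) hxe
  obtain ⟨s, hs, hs'⟩ := hH' r fun i => ⟨i + 2, r (i + 1), getElem?_initSeg (by omega)⟩
  obtain rfl : s = fun i => r (i + 1) := by
    funext i
    obtain ⟨t, ht⟩ := hs' i
    have hk : i + 1 < t := by
      by_contra hk
      rw [List.getElem?_eq_none (by simpa using hk)] at ht
      simp at ht
    rw [getElem?_initSeg hk, Option.some_inj] at ht
    exact ht.symm
  exact ⟨_, hs, x', hx', ⟨⟨i, j, hij, hne⟩, hsum⟩, (hA x').1 hx⟩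

/-! ### Covering open sets by nonoverlapping dyadic cells -/

/-- The half-open dyadic cell with index `j` at level `s`. -/
def dyadicCell (s j : ℕ) : Set ℝ := Ico ((j : ℝ) * 2⁻¹ ^ s) (((j : ℝ) + 1) * 2⁻¹ ^ s)

theorem mem_dyadicCell {s j : ℕ} {x : ℝ} : x ∈ dyadicCell s j ↔ 0 ≤ x ∧ ⌊x * 2 ^ s⌋₊ = j := by
  have hs : (0 : ℝ) < 2 ^ s := by positivity
  have key : x ∈ dyadicCell s j ↔ (j : ℝ) ≤ x * 2 ^ s ∧ x * 2 ^ s < (j : ℝ) + 1 := by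
    rw [dyadicCell, mem_Ico, inv_pow, ← div_eq_mul_inv, ← div_eq_mul_inv, div_le_iff₀ hs,
      lt_div_iff₀ hs]
  rw [key]
  constructor
  · intro h
    have hx : 0 ≤ x * 2 ^ s := (Nat.cast_nonneg j).trans h.1
    exact ⟨nonneg_of_mul_nonneg_left hx hs, (Nat.floor_eq_iff hx).2 h⟩
  · rintro ⟨hx, h⟩
    exact (Nat.floor_eq_iff (by positivity)).1 h

theorem volume_dyadicCell (s j : ℕ) : volume (dyadicCell s j) = ENNReal.ofReal (2⁻¹ ^ s) := by
  rw [dyadicCell, Real.volume_Ico]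
  congr 1
  ring

/-- Passing to the enclosing cell `d` levels up is integer division of the index by `2 ^ d`. -/
theorem floor_mul_two_pow_div (x : ℝ) {s d : ℕ} :
    ⌊x * 2 ^ (s + d)⌋₊ / 2 ^ d = ⌊x * 2 ^ s⌋₊ := by
  have h := Nat.floor_div_natCast (x * 2 ^ (s + d)) (2 ^ d)
  rw [← h]
  congr 1
  push_cast
  rw [pow_add, ← mul_assoc, mul_div_cancel_right₀ _ (by positivity)]

/-- The closed dyadic cell `j` at level `s` meets the closed interval with center `c` and positive
radius `r`. -/
def Touches (c r : ℚ) (s j : ℕ) : Prop :=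
  0 < r ∧ (j : ℚ) * 2⁻¹ ^ s ≤ c + r ∧ c - r ≤ ((j : ℚ) + 1) * 2⁻¹ ^ s

instance (c r : ℚ) (s j : ℕ) : Decidable (Touches c r s j) :=
  inferInstanceAs (Decidable (_ ∧ _ ∧ _))

/-- The center of the ball of `[0,1]` with code `m`. -/
def ballCenter (m : ℕ) : ℚ := clampRat (ratNum m.unpair.1)

/-- The radius of the ball with code `m`. -/
def ballRadius (m : ℕ) : ℚ := ratNum m.unpair.2

/-- The cell `j` at level `n + k + 5` touches the `k`-th ball of the list `b`, and none of the cells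
that contain it touches an earlier ball at the level of that ball. -/
def Fresh (b : ℕ → ℕ) (n k j : ℕ) : Prop :=
  j ≤ 2 ^ (n + k + 5) ∧ Touches (ballCenter (b k)) (ballRadius (b k)) (n + k + 5) j ∧
    ∀ i < k, ¬ Touches (ballCenter (b i)) (ballRadius (b i)) (n + i + 5) (j / 2 ^ (k - i))

instance (b : ℕ → ℕ) (n k j : ℕ) : Decidable (Fresh b n k j) :=
  inferInstanceAs (Decidable (_ ∧ _ ∧ _))

theorem Fresh.congr {b b' : ℕ → ℕ} {k : ℕ} (h : ∀ i ≤ k, b i = b' i) {n j : ℕ} :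
    Fresh b n k j ↔ Fresh b' n k j := by
  rw [Fresh, Fresh, h k le_rfl]
  refine and_congr_right fun _ => and_congr_right fun _ => forall₂_congr fun i hi => ?_
  rw [h i hi.le]

/-- The cell of the pair coded by `m`, if it is fresh. -/
def freshCell (b : ℕ → ℕ) (n m : ℕ) : Set ℝ :=
  if Fresh b n m.unpair.1 m.unpair.2 then dyadicCell (n + m.unpair.1 + 5) m.unpair.2 else ∅

theorem mem_freshCell {b : ℕ → ℕ} {n m : ℕ} {x : ℝ} : x ∈ freshCell b n m ↔
    Fresh b n m.unpair.1 m.unpair.2 ∧ x ∈ dyadicCell (n + m.unpair.1 + 5) m.unpair.2 := by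
  rw [freshCell]
  split_ifs with h <;> simp [h]

theorem measurableSet_freshCell (b : ℕ → ℕ) (n m : ℕ) : MeasurableSet (freshCell b n m) := by
  rw [freshCell]
  split_ifs
  exacts [measurableSet_Ico, .empty]

/-- If two fresh cells share a point, the coarser one contains the finer. The coarser touches its
ball, which is just what freshness of the finer one forbids. -/
theorem Fresh.not_lt {b : ℕ → ℕ} {n k j k' j' : ℕ} (h : Fresh b n k j) (h' : Fresh b n k' j')
    {x : ℝ} (hx : x ∈ dyadicCell (n + k + 5) j) (hx' : x ∈ dyadicCell (n + k' + 5) j') :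
    ¬ k < k' := by
  intro hk
  obtain ⟨-, rfl⟩ := mem_dyadicCell.1 hx
  obtain ⟨-, rfl⟩ := mem_dyadicCell.1 hx'
  have h1 := h'.2.2 k hk
  have h2 : n + k' + 5 = n + k + 5 + (k' - k) := by omega
  rw [h2, floor_mul_two_pow_div] at h1
  exact h1 h.2.1

theorem pairwise_disjoint_freshCell (b : ℕ → ℕ) (n : ℕ) :
    Pairwise (Function.onFun Disjoint (freshCell b n)) := by
  intro m m' hm
  refine Set.disjoint_left.2 fun x hx hx' => hm ?_
  obtain ⟨h, hx⟩ := mem_freshCell.1 hx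
  obtain ⟨h', hx'⟩ := mem_freshCell.1 hx'
  have hk : m.unpair.1 = m'.unpair.1 :=
    le_antisymm (not_lt.1 (h'.not_lt h hx' hx)) (not_lt.1 (h.not_lt h' hx hx'))
  have hj : m.unpair.2 = m'.unpair.2 := by
    rw [← (mem_dyadicCell.1 hx).2, ← (mem_dyadicCell.1 hx').2, hk]
  rw [← Nat.pair_unpair m, ← Nat.pair_unpair m', hk, hj]

/-- The union of the open intervals that underlie the balls of the list `b`. -/
def ballUnion (b : ℕ → ℕ) : Set ℝ :=
  ⋃ k, Ioo ((ballCenter (b k) : ℝ) - ballRadius (b k)) (ballCenter (b k) + ballRadius (b k))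

theorem measurableSet_ballUnion (b : ℕ → ℕ) : MeasurableSet (ballUnion b) :=
  .iUnion fun _ => measurableSet_Ioo

theorem mem_ballUnion_iff {b : ℕ → ℕ} {x : unitInterval} :
    (x : ℝ) ∈ ballUnion b ↔ x ∈ ⋃ k, ratBall unitInterval (b k) := by
  simp only [ballUnion, mem_iUnion, mem_ratBall_unitInterval, mem_Ioo, ballCenter, ballRadius,
    abs_lt]
  refine exists_congr fun k => ?_
  constructor <;> rintro ⟨h1, h2⟩ <;> constructor <;> linarith

theorem touches_cast_iff {c r : ℚ} {s j : ℕ} : Touches c r s j ↔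
    (0 : ℝ) < r ∧ (j : ℝ) * 2⁻¹ ^ s ≤ c + r ∧ (c : ℝ) - r ≤ ((j : ℝ) + 1) * 2⁻¹ ^ s := by
  rw [Touches, ← Rat.cast_pos (K := ℝ), ← Rat.cast_le (K := ℝ), ← Rat.cast_le (K := ℝ)]
  push_cast
  rfl

/-- A point of ball `k` lies in a cell of level `n + k + 5` touching that ball. For the least `k` at
which the cell of the point touches, that cell is fresh. -/
theorem exists_fresh {b : ℕ → ℕ} (n : ℕ) {x : ℝ} (hx : x ∈ Icc (0 : ℝ) 1)
    (hU : x ∈ ballUnion b) : ∃ k j, Fresh b n k j ∧ x ∈ dyadicCell (n + k + 5) j := by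
  classical
  have hex : ∃ k, Touches (ballCenter (b k)) (ballRadius (b k)) (n + k + 5)
      ⌊x * 2 ^ (n + k + 5)⌋₊ := by
    obtain ⟨k, hk1, hk2⟩ := mem_iUnion.1 hU
    have hc : x ∈ dyadicCell (n + k + 5) ⌊x * 2 ^ (n + k + 5)⌋₊ := mem_dyadicCell.2 ⟨hx.1, rfl⟩
    exact ⟨k, touches_cast_iff.2 ⟨by linarith, hc.1.trans hk2.le, hk1.le.trans hc.2.le⟩⟩
  refine ⟨Nat.find hex, _, ⟨?_, Nat.find_spec hex, fun i hi => ?_⟩, mem_dyadicCell.2 ⟨hx.1, rfl⟩⟩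
  -- The index `2 ^ (n + k + 5)` itself is needed for the point `1`, since cells are open on the
  -- right.
  · refine Nat.floor_le_of_le ?_
    push_cast
    exact mul_le_of_le_one_left (by positivity) hx.2
  · have h2 : n + Nat.find hex + 5 = n + i + 5 + (Nat.find hex - i) := by omega
    rw [h2, floor_mul_two_pow_div]
    exact Nat.find_min hex hi

/-- A touching cell exceeds its ball by at most one cell length on either side, and `[0,1]` by at
most one on the right. The error is at most the sum over `k` of `3 * 2⁻¹ ^ (n + k + 5)`, that is
`3/16 * 2⁻¹ ^ n`. -/
theorem volume_iUnion_freshCell_le (b : ℕ → ℕ) (n : ℕ) : volume (⋃ m, freshCell b n m) ≤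
    volume (ballUnion b ∩ Icc 0 1) + ENNReal.ofReal (3 / 16 * 2⁻¹ ^ n) := by
  let w : ℕ → ℝ := fun k => 2⁻¹ ^ (n + k + 5)
  let c : ℕ → ℝ := fun k => ballCenter (b k)
  let r : ℕ → ℝ := fun k => ballRadius (b k)
  let S : ℕ → Set ℝ := fun k =>
    (Icc (c k - r k - w k) (c k - r k) ∪ Icc (c k + r k) (c k + r k + w k)) ∪ Icc 1 (1 + w k)
  have hw : ∀ k, 0 < w k := fun k => by positivity
  have hsub : (⋃ m, freshCell b n m) ⊆ (ballUnion b ∩ Icc 0 1) ∪ ⋃ k, S k := by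
    refine iUnion_subset fun m x hx => ?_
    obtain ⟨⟨hj, ht, -⟩, hx⟩ := mem_freshCell.1 hx
    have hx0 := (mem_dyadicCell.1 hx).1
    generalize m.unpair.1 = k at *
    generalize m.unpair.2 = j at *
    obtain ⟨-, h1, h2⟩ := touches_cast_iff.1 ht
    obtain ⟨h3, h4⟩ := hx
    have h4' : x < (j : ℝ) * w k + w k := by
      rw [← add_one_mul]; exact h4
    have h2' : c k - r k ≤ (j : ℝ) * w k + w k := by
      rw [← add_one_mul]; exact h2
    have h1' : (j : ℝ) * w k ≤ c k + r k := h1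
    have h3' : (j : ℝ) * w k ≤ x := h3
    have hj' : (j : ℝ) * w k ≤ 1 := by
      have h5 : (j : ℝ) ≤ 2 ^ (n + k + 5) := by exact_mod_cast hj
      calc (j : ℝ) * w k ≤ 2 ^ (n + k + 5) * w k := by gcongr
        _ = 1 := by rw [← mul_pow]; norm_num
    by_cases hx1 : x ≤ 1
    · by_cases hl : x ≤ c k - r k
      · exact Or.inr (mem_iUnion.2 ⟨k, Or.inl (Or.inl ⟨by linarith, hl⟩)⟩)
      by_cases hr : c k + r k ≤ x
      · exact Or.inr (mem_iUnion.2 ⟨k, Or.inl (Or.inr ⟨hr, by linarith⟩)⟩)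
      exact Or.inl ⟨mem_iUnion.2 ⟨k, not_le.1 hl, not_le.1 hr⟩, hx0, hx1⟩
    · exact Or.inr (mem_iUnion.2 ⟨k, Or.inr ⟨(not_le.1 hx1).le, by linarith⟩⟩)
  have hS : ∀ k, volume (S k) ≤ ENNReal.ofReal (3 * w k) := by
    intro k
    have h3 : 3 * w k = w k + w k + w k := by ring
    rw [h3, ENNReal.ofReal_add (by linarith [hw k]) (hw k).le,
      ENNReal.ofReal_add (hw k).le (hw k).le]
    refine (measure_union_le _ _).trans (add_le_add ((measure_union_le _ _).trans
      (add_le_add ?_ ?_)) ?_) <;> rw [Real.volume_Icc] <;> apply ENNReal.ofReal_le_ofReal <;>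
      linarith
  have hw' : ∀ k, 3 * w k = 3 / 32 * 2⁻¹ ^ n * 2⁻¹ ^ k := fun k => by
    simp only [w, pow_add]
    ring
  have hsum : ∑' k, ENNReal.ofReal (3 * w k) = ENNReal.ofReal (3 / 16 * 2⁻¹ ^ n) := by
    simp only [hw']
    rw [← ENNReal.ofReal_tsum_of_nonneg (fun k => by positivity)
      ((summable_geometric_of_lt_one (by norm_num) (by norm_num)).mul_left _), tsum_mul_left,
      tsum_geometric_inv_two]
    congr 1
    ring
  calc _ ≤ volume (ballUnion b ∩ Icc 0 1) + volume (⋃ k, S k) :=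
        (measure_mono hsub).trans (measure_union_le _ _)
    _ ≤ volume (ballUnion b ∩ Icc 0 1) + ∑' k, volume (S k) := by
        gcongr
        exact measure_iUnion_le _
    _ ≤ _ := by
        rw [← hsum]
        gcongr with k
        exact hS k

theorem volume_ballUnion_add (b : ℕ → ℕ) :
    volume (ballUnion b ∩ Icc 0 1) + volume (⋃ k, ratBall unitInterval (b k))ᶜ = 1 := by
  have h : (Subtype.val '' (⋃ k, ratBall unitInterval (b k))ᶜ) = Icc (0 : ℝ) 1 \ ballUnion b := by
    ext x
    constructor
    · rintro ⟨x, hx, rfl⟩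
      exact ⟨x.2, fun h => hx (mem_ballUnion_iff.1 h)⟩
    · rintro ⟨hx, h⟩
      exact ⟨⟨x, hx⟩, fun h' => h (mem_ballUnion_iff.2 h'), rfl⟩
  rw [unitInterval.volume_apply, h, inter_comm, measure_inter_add_sdiff _
    (measurableSet_ballUnion b), Real.volume_Icc]
  simp

/-! ### The instance of `ACT` for an instance of `*-WWKL` -/

/-- The left endpoints of the covering intervals: the first three intervals leave of `[0,1]` only
`[L, 2 L]` with `L = 2 ^ (- 2 n - 1)`, the others are enlarged images of the fresh cells under
`x ↦ L (1 + x)`. -/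
def coverLeft (b : ℕ → ℕ) (n m : ℕ) : ℚ :=
  if m = 0 then -2⁻¹ ^ (3 * n + 4) else
  if m = 1 then -2⁻¹ ^ (3 * n + 4) else
  if m = 2 then 2 * 2⁻¹ ^ (2 * n + 1) else
  if Fresh b n (m - 3).unpair.1 (m - 3).unpair.2 then
    2⁻¹ ^ (2 * n + 1) * (1 + 2⁻¹ ^ (n + (m - 3).unpair.1 + 5) *
      ((m - 3).unpair.2 - 2⁻¹ ^ (n + 3)))
  else 0

/-- The right endpoints of the covering intervals. -/
def coverRight (b : ℕ → ℕ) (n m : ℕ) : ℚ :=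
  if m = 0 then 2⁻¹ ^ (2 * n + 1) else
  if m = 1 then 0 else
  if m = 2 then 1 + 2⁻¹ ^ (3 * n + 4) else
  if Fresh b n (m - 3).unpair.1 (m - 3).unpair.2 then
    2⁻¹ ^ (2 * n + 1) * (1 + 2⁻¹ ^ (n + (m - 3).unpair.1 + 5) *
      ((m - 3).unpair.2 + 1 + 2⁻¹ ^ (n + 3)))
  else 0

/-- The covering intervals for the balls `b` and the threshold `2⁻ⁿ`. -/
def coverSeq (b : ℕ → ℕ) (n : ℕ) : IntervalSeq := ⟨coverLeft b n, coverRight b n⟩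

theorem coverSeq_zero (b : ℕ → ℕ) (n : ℕ) : (coverSeq b n).interval 0 =
    Ioo (-2⁻¹ ^ (3 * n + 4)) (2⁻¹ ^ (2 * n + 1) : ℝ) := by
  simp [coverSeq, IntervalSeq.interval, coverLeft, coverRight]

theorem coverSeq_one (b : ℕ → ℕ) (n : ℕ) : (coverSeq b n).interval 1 =
    Ioo (-2⁻¹ ^ (3 * n + 4)) (0 : ℝ) := by
  simp [coverSeq, IntervalSeq.interval, coverLeft, coverRight]

theorem coverSeq_two (b : ℕ → ℕ) (n : ℕ) : (coverSeq b n).interval 2 =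
    Ioo (2 * 2⁻¹ ^ (2 * n + 1)) (1 + 2⁻¹ ^ (3 * n + 4) : ℝ) := by
  simp [coverSeq, IntervalSeq.interval, coverLeft, coverRight]

theorem coverSeq_add_three (b : ℕ → ℕ) (n m : ℕ) : (coverSeq b n).interval (m + 3) =
    if Fresh b n m.unpair.1 m.unpair.2 then
      Ioo (2⁻¹ ^ (2 * n + 1) * (1 + 2⁻¹ ^ (n + m.unpair.1 + 5) *
        ((m.unpair.2 : ℝ) - 2⁻¹ ^ (n + 3))))
      (2⁻¹ ^ (2 * n + 1) * (1 + 2⁻¹ ^ (n + m.unpair.1 + 5) *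
        ((m.unpair.2 : ℝ) + 1 + 2⁻¹ ^ (n + 3))))
    else ∅ := by
  split_ifs with h <;> simp [coverSeq, IntervalSeq.interval, coverLeft, coverRight, h]

/-- The map to the window scales by `L`, and a margin of `2⁻¹ ^ (n + 3)` cell lengths on each side
gives the other factor. -/
theorem volume_coverSeq_add_three (b : ℕ → ℕ) (n m : ℕ) :
    volume ((coverSeq b n).interval (m + 3)) =
      ENNReal.ofReal (2⁻¹ ^ (2 * n + 1) * (1 + 2 * 2⁻¹ ^ (n + 3))) *
        volume (freshCell b n m) := by
  rw [coverSeq_add_three, freshCell]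
  split_ifs
  · rw [Real.volume_Ioo, volume_dyadicCell, ← ENNReal.ofReal_mul (by positivity)]
    congr 1
    ring
  · simp

/-- Interval `1` lies to the left of `0`, inside interval `0`; it only serves to produce an overlap.
-/
theorem coverSeq_nonDisjoint (b : ℕ → ℕ) (n : ℕ) : (coverSeq b n).NonDisjoint := by
  refine ⟨0, 1, by norm_num, -2⁻¹ ^ (3 * n + 4) / 2, ?_⟩
  rw [coverSeq_zero, coverSeq_one]
  have h : (0 : ℝ) < 2⁻¹ ^ (3 * n + 4) := by positivity
  have h' : (0 : ℝ) < 2⁻¹ ^ (2 * n + 1) := by positivity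
  refine ⟨⟨?_, ?_⟩, ?_, ?_⟩ <;> linarith

theorem tsum_volume_coverSeq_lt_one {b : ℕ → ℕ} {n : ℕ}
    (h : (2⁻¹ : ℝ≥0∞) ^ n < volume (⋃ k, ratBall unitInterval (b k))ᶜ) :
    ∑' m, volume ((coverSeq b n).interval m) < 1 := by
  set δ : ℝ := 2⁻¹ ^ n with hδ
  have hδ0 : 0 < δ := by positivity
  have hδ1 : δ ≤ 1 := pow_le_one₀ (by norm_num) (by norm_num)
  obtain ⟨M, hM0, hM, hM1⟩ : ∃ M : ℝ, 0 ≤ M ∧ volume (⋃ m, freshCell b n m) = ENNReal.ofReal M ∧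
      M ≤ 1 - 13 / 16 * δ := by
    have h1 := volume_iUnion_freshCell_le b n
    have h2 := volume_ballUnion_add b
    have hu : volume (ballUnion b ∩ Icc 0 1) ≠ ∞ :=
      ((le_self_add.trans_eq h2).trans_lt ENNReal.one_lt_top).ne
    have ha : volume (⋃ k, ratBall unitInterval (b k))ᶜ ≠ ∞ := measure_ne_top _ _
    rw [← ofReal_inv_two_pow] at h
    rw [← ENNReal.ofReal_toReal hu, ← ENNReal.ofReal_toReal ha,
      ← ENNReal.ofReal_add ENNReal.toReal_nonneg ENNReal.toReal_nonneg,
      ENNReal.ofReal_eq_one] at h2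
    rw [← ENNReal.ofReal_toReal ha, ENNReal.ofReal_lt_ofReal_iff_of_nonneg hδ0.le] at h
    rw [← ENNReal.ofReal_toReal hu,
      ← ENNReal.ofReal_add ENNReal.toReal_nonneg (by positivity)] at h1
    have hm := (h1.trans_lt ENNReal.ofReal_lt_top).ne
    refine ⟨_, ENNReal.toReal_nonneg, (ENNReal.ofReal_toReal hm).symm, ?_⟩
    have h3 := ENNReal.toReal_le_of_le_ofReal (by positivity) h1
    linarith
  set L : ℝ := 2⁻¹ ^ (2 * n + 1) with hL
  have hL0 : 0 < L := by positivity
  have hL1 : 2 * L ≤ 1 := by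
    have : L ≤ 2⁻¹ := pow_le_of_le_one (by norm_num) (by norm_num) (by omega)
    linarith
  have he : (2⁻¹ : ℝ) ^ (3 * n + 4) = L * δ / 8 := by
    rw [hL, hδ]; ring
  have hh : (2⁻¹ : ℝ) ^ (n + 3) = δ / 8 := by
    rw [hδ]; ring
  have hLδ : 0 < L * δ := by positivity
  rw [← ENNReal.summable.sum_add_tsum_nat_add' (k := 3)]
  simp only [volume_coverSeq_add_three, Finset.sum_range_succ, Finset.sum_range_zero, zero_add,
    coverSeq_zero, coverSeq_one, coverSeq_two, Real.volume_Ioo]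
  rw [ENNReal.tsum_mul_left, ← measure_iUnion (pairwise_disjoint_freshCell b n)
    (measurableSet_freshCell b n), hM, ← ENNReal.ofReal_mul (by positivity),
    ← hL, he, hh, ← ENNReal.ofReal_add (by linarith) (by linarith),
    ← ENNReal.ofReal_add (by linarith) (by linarith),
    ← ENNReal.ofReal_add (by linarith) (by positivity), ENNReal.ofReal_lt_one]
  -- The outer intervals have total length `1 - L + 3Lδ/8`, so the whole sum is at most `1 - 3Lδ/16
  -- - 13Lδ²/64`.
  have h4 : L * (1 + 2 * (δ / 8)) * M ≤ L * (1 + 2 * (δ / 8)) * (1 - 13 / 16 * δ) := by gcongr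
  nlinarith [mul_pos hLδ hδ0]

theorem coverSeq_mem_ACT_dom {b : ℕ → ℕ} {n : ℕ}
    (h : (2⁻¹ : ℝ≥0∞) ^ n < volume (⋃ k, ratBall unitInterval (b k))ᶜ) :
    coverSeq b n ∈ ACT.dom := by
  rw [dom_ACT]
  exact ⟨coverSeq_nonDisjoint b n, tsum_volume_coverSeq_lt_one h⟩

theorem exists_of_not_mem_coverSeq {b : ℕ → ℕ} {n : ℕ} {x : unitInterval}
    (hx : (x : ℝ) ∉ ⋃ m, (coverSeq b n).interval m) :
    ∃ y : unitInterval, (x : ℝ) = 2⁻¹ ^ (2 * n + 1) * (1 + y) ∧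
      y ∉ ⋃ k, ratBall unitInterval (b k) := by
  simp only [mem_iUnion, not_exists] at hx
  have h0 := hx 0
  have h2 := hx 2
  rw [coverSeq_zero, mem_Ioo, not_and, not_lt] at h0
  rw [coverSeq_two, mem_Ioo, not_and, not_lt] at h2
  set L : ℝ := 2⁻¹ ^ (2 * n + 1) with hL
  have hL0 : 0 < L := by positivity
  have he : (0 : ℝ) < 2⁻¹ ^ (3 * n + 4) := by positivity
  have hx0 := h0 (by linarith [x.2.1])
  have hx1 : (x : ℝ) ≤ 2 * L := by
    by_contra h
    linarith [h2 (not_le.1 h), x.2.2]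
  have hxy : (x : ℝ) = L * (1 + ((x : ℝ) - L) / L) := by
    field_simp
    ring
  refine ⟨⟨((x : ℝ) - L) / L, div_nonneg (by linarith) hL0.le,
    (div_le_one hL0).2 (by linarith)⟩, hxy, fun hU => ?_⟩
  obtain ⟨k, j, hf, hc⟩ := exists_fresh n (Subtype.mem _) (mem_ballUnion_iff.2 hU)
  refine hx (Nat.pair k j + 3) ?_
  rw [coverSeq_add_three, Nat.unpair_pair, if_pos hf]
  rw [hxy, ← hL, mem_Ioo, mul_lt_mul_iff_right₀ hL0, mul_lt_mul_iff_right₀ hL0]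
  obtain ⟨h3, h4⟩ := hc
  -- The margin turns the weak left bound of the half-open cell into a strict one.
  have hw : (0 : ℝ) < 2⁻¹ ^ (n + k + 5) * 2⁻¹ ^ (n + 3) := by positivity
  dsimp only at h3 h4 ⊢
  constructor <;> linarith

/-! ### Computability of the covering intervals -/

section Computability

variable {α : Type} [Primcodable α]

theorem primrecPred_touches {c r : α → ℚ} {s j : α → ℕ} (hc : PrimrecRat c) (hr : PrimrecRat r)
    (hs : Primrec s) (hj : Primrec j) : PrimrecPred fun a => Touches (c a) (r a) (s a) (j a) := by
  have hw := PrimrecRat.inv_two_pow hs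
  have hj' := PrimrecRat.natCast hj
  exact ((PrimrecRat.const 0).lt hr).and (((hj'.mul hw).le (hc.add hr)).and
    ((hc.sub hr).le ((hj'.add (.const 1)).mul hw)))

theorem primrecPred_fresh {b : α → ℕ → ℕ} {n k j : α → ℕ} (hb : Primrec₂ b) (hn : Primrec n)
    (hk : Primrec k) (hj : Primrec j) : PrimrecPred fun a => Fresh (b a) (n a) (k a) (j a) := by
  have hlevel : ∀ {β : Type} [Primcodable β] {f g : β → ℕ}, Primrec f → Primrec g →
      Primrec fun x => f x + g x + 5 := fun hf hg =>
    Primrec.nat_add.comp (Primrec.nat_add.comp hf hg) (Primrec.const 5)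
  have htouch : ∀ {β : Type} [Primcodable β] {f s j : β → ℕ}, Primrec f → Primrec s →
      Primrec j → PrimrecPred fun x => Touches (ballCenter (f x)) (ballRadius (f x)) (s x) (j x) :=
    fun hf hs hj => primrecPred_touches
      (PrimrecRat.clampRat (.ratNum (Primrec.fst.comp (Primrec.unpair.comp hf))))
      (.ratNum (Primrec.snd.comp (Primrec.unpair.comp hf))) hs hj
  have hnk := hlevel hn hk
  refine (Primrec.nat_le.comp hj (primrec_two_pow hnk)).and
    ((htouch (hb.comp Primrec.id hk) hnk hj).and ?_)
  have hR : PrimrecRel fun (i : ℕ) (a : α) =>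
      ¬ Touches (ballCenter (b a i)) (ballRadius (b a i)) (n a + i + 5) (j a / 2 ^ (k a - i)) :=
    (htouch (hb.comp Primrec.snd Primrec.fst) (hlevel (hn.comp Primrec.snd) Primrec.fst)
      (Primrec.nat_div.comp (hj.comp Primrec.snd)
        (primrec_two_pow (Primrec.nat_sub.comp (hk.comp Primrec.snd) Primrec.fst)))).not
  exact (hR.forall_mem_list.comp (Primrec.list_range.comp hk) Primrec.id).of_eq fun a => by simp

theorem primrecRat_coverLeft {b : α → ℕ → ℕ} {n m : α → ℕ} (hb : Primrec₂ b) (hn : Primrec n)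
    (hm : Primrec m) : PrimrecRat fun a => coverLeft (b a) (n a) (m a) := by
  have hlin : ∀ k l : ℕ, PrimrecRat fun a => (2⁻¹ : ℚ) ^ (k * n a + l) := fun k l =>
    .inv_two_pow (Primrec.nat_add.comp (Primrec.nat_mul.comp (Primrec.const k) hn)
      (Primrec.const l))
  have heq : ∀ i : ℕ, PrimrecPred fun a => m a = i := fun i =>
    Primrec.eq.comp hm (Primrec.const i)
  have hu := Primrec.unpair.comp (Primrec.nat_sub.comp hm (Primrec.const 3))
  have hneg := ((PrimrecRat.const 0).sub (hlin 3 4)).of_eq fun a => zero_sub _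
  refine .ite (heq 0) hneg (.ite (heq 1) hneg (.ite (heq 2)
    ((PrimrecRat.const 2).mul (hlin 2 1)) (.ite (primrecPred_fresh hb hn (Primrec.fst.comp hu)
      (Primrec.snd.comp hu)) ((hlin 2 1).mul ((PrimrecRat.const 1).add (.mul ?_ ?_))) (.const 0))))
  · exact .inv_two_pow (Primrec.nat_add.comp (Primrec.nat_add.comp hn (Primrec.fst.comp hu))
      (Primrec.const 5))
  · exact .sub (.natCast (Primrec.snd.comp hu))
      (.inv_two_pow (Primrec.nat_add.comp hn (Primrec.const 3)))

theorem primrecRat_coverRight {b : α → ℕ → ℕ} {n m : α → ℕ} (hb : Primrec₂ b) (hn : Primrec n)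
    (hm : Primrec m) : PrimrecRat fun a => coverRight (b a) (n a) (m a) := by
  have hlin : ∀ k l : ℕ, PrimrecRat fun a => (2⁻¹ : ℚ) ^ (k * n a + l) := fun k l =>
    .inv_two_pow (Primrec.nat_add.comp (Primrec.nat_mul.comp (Primrec.const k) hn)
      (Primrec.const l))
  have heq : ∀ i : ℕ, PrimrecPred fun a => m a = i := fun i =>
    Primrec.eq.comp hm (Primrec.const i)
  have hu := Primrec.unpair.comp (Primrec.nat_sub.comp hm (Primrec.const 3))
  refine .ite (heq 0) (hlin 2 1) (.ite (heq 1) (.const 0) (.ite (heq 2)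
    ((PrimrecRat.const 1).add (hlin 3 4)) (.ite (primrecPred_fresh hb hn (Primrec.fst.comp hu)
      (Primrec.snd.comp hu)) ((hlin 2 1).mul ((PrimrecRat.const 1).add (.mul ?_ ?_))) (.const 0))))
  · exact .inv_two_pow (Primrec.nat_add.comp (Primrec.nat_add.comp hn (Primrec.fst.comp hu))
      (Primrec.const 5))
  · exact .add (.add (.natCast (Primrec.snd.comp hu)) (.const 1))
      (.inv_two_pow (Primrec.nat_add.comp hn (Primrec.const 3)))

end Computability

/-- Interval `m` depends on finitely many balls: the ball index coded by `m - 3` is at most `m`. -/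
theorem coverLeft_congr {b b' : ℕ → ℕ} {n m : ℕ} (h : ∀ i ≤ m, b i = b' i) :
    coverLeft b n m = coverLeft b' n m := by
  have := Fresh.congr (b := b) (b' := b') (k := (m - 3).unpair.1) (n := n)
    (j := (m - 3).unpair.2) fun i hi =>
      h i (hi.trans ((Nat.unpair_left_le _).trans (Nat.sub_le _ _)))
  simp only [coverLeft, this]

theorem coverRight_congr {b b' : ℕ → ℕ} {n m : ℕ} (h : ∀ i ≤ m, b i = b' i) :
    coverRight b n m = coverRight b' n m := by
  have := Fresh.congr (b := b) (b' := b') (k := (m - 3).unpair.1) (n := n)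
    (j := (m - 3).unpair.2) fun i hi =>
      h i (hi.trans ((Nat.unpair_left_le _).trans (Nat.sub_le _ _)))
  simp only [coverRight, this]

/-- The covering intervals of an instance of `*-WWKL` can be computed from a name of it. -/
theorem exists_coverSeq_functional : ∃ K : (ℕ → ℕ) →. (ℕ → ℕ), ComputableFunctional K ∧
    ∀ p, ∃ q ∈ K p, coverSeq (fun k => p (k + 1)) (p 0) ∈
      RepresentedSpace.rep (X := IntervalSeq) q := by
  have hb : Primrec₂ fun (a : List ℕ × ℕ) (i : ℕ) => a.1.getD (i + 1) 0 :=
    (Primrec.list_getD 0).comp (Primrec.fst.comp Primrec.fst) (Primrec.succ.comp Primrec.snd)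
  have hn : Primrec fun a : List ℕ × ℕ => a.1.getD 0 0 :=
    (Primrec.list_getD 0).comp Primrec.fst (Primrec.const 0)
  obtain ⟨l, hl, hl'⟩ := primrecRat_coverLeft hb hn Primrec.snd
  obtain ⟨r, hr, hr'⟩ := primrecRat_coverRight hb hn Primrec.snd
  obtain ⟨K, hK, hK'⟩ := exists_computableFunctional
    -- Position `0` of the name holds the threshold, so ball `m` sits at position `m + 1`.
    (g := fun u m => if m + 1 < u.length then some (Nat.pair (l (u, m)) (r (u, m))) else none)
    (Primrec.ite (Primrec.nat_lt.comp (Primrec.succ.comp Primrec.snd)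
      (Primrec.list_length.comp Primrec.fst)) (Primrec.option_some.comp
        (Primrec₂.natPair.comp hl hr)) (Primrec.const none))
  refine ⟨K, hK, fun p => ?_⟩
  obtain ⟨q, hq, hq'⟩ := hK' p fun m => ⟨m + 2, _, if_pos (by simp)⟩
  refine ⟨q, hq, Part.mem_some_iff.2 ?_⟩
  have key : ∀ m, ratNum (q m).unpair.1 = coverLeft (fun k => p (k + 1)) (p 0) m ∧
      ratNum (q m).unpair.2 = coverRight (fun k => p (k + 1)) (p 0) m := by
    intro m
    obtain ⟨t, ht⟩ := hq' m
    rw [ite_eq_iff] at ht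
    simp only [length_initSeg, reduceCtorEq, and_false, or_false, Option.some.injEq] at ht
    obtain ⟨hmt, ht⟩ := ht
    have h0 : (initSeg p t).getD 0 0 = p 0 := getD_initSeg (by omega)
    have h1 : ∀ i ≤ m, (initSeg p t).getD (i + 1) 0 = p (i + 1) := fun i hi =>
      getD_initSeg (by omega)
    rw [← ht, Nat.unpair_pair, hl', hr']
    simp only [h0]
    exact ⟨coverLeft_congr h1, coverRight_congr h1⟩
  simp only [coverSeq, key]

/-! ### Recovering the threshold and the point -/

/-- The digits of a name of a solution of `*-WWKL`, from a name of an uncovered point. -/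
def decodeDigits (d : ℕ × ℕ → ℕ) (u : List ℕ) (i : ℕ) : Option ℕ :=
  let m := (u.length - 1).unpair.1
  let n := (u.length - 1).unpair.2
  let x := clampRat (ratNum (u.getD m 0))
  if 3 / 4 * 2⁻¹ ^ (2 * n + 1) < x - 2⁻¹ ^ m ∧ x + 2⁻¹ ^ m < 3 * 2⁻¹ ^ (2 * n + 1) then
    Nat.casesOn i (some n) fun i => (u[i + (2 * n + 1)]?).map fun a => d (n, a)
  else none

theorem primrec_decodeDigits {d : ℕ × ℕ → ℕ} (hd : Primrec d) : Primrec₂ (decodeDigits d) := by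
  have hw : Primrec fun a : List ℕ × ℕ => (a.1.length - 1).unpair :=
    Primrec.unpair.comp (Primrec.pred.comp (Primrec.list_length.comp Primrec.fst))
  have hm := Primrec.fst.comp hw
  have hn := Primrec.snd.comp hw
  have hl : Primrec fun a : List ℕ × ℕ => 2 * (a.1.length - 1).unpair.2 + 1 :=
    Primrec.nat_double_succ.comp hn
  have hx := PrimrecRat.clampRat
    (.ratNum ((Primrec.list_getD 0).comp (Primrec.fst (α := List ℕ) (β := ℕ)) hm))
  have hL := PrimrecRat.inv_two_pow hl
  have he := PrimrecRat.inv_two_pow hm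
  refine Primrec.ite ((((PrimrecRat.const (3 / 4)).mul hL).lt (hx.sub he)).and
    ((hx.add he).lt ((PrimrecRat.const 3).mul hL))) ?_ (Primrec.const none)
  refine Primrec.nat_casesOn Primrec.snd (Primrec.option_some.comp hn) ?_
  refine Primrec.option_map (Primrec.list_getElem?.comp
    (Primrec.fst.comp Primrec.fst) (Primrec.nat_add.comp Primrec.snd (hl.comp Primrec.fst))) ?_
  exact hd.comp ((hn.comp (Primrec.fst.comp Primrec.fst)).pair Primrec.snd)

/-- Changing `n` by one changes `L` by a factor of `4`, so the enlarged window `(3L/4, 3L)` for one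
index misses the window `[L, 2L]` for any other. -/
theorem eq_of_pow_lt {n n' : ℕ} {x : ℝ} (h1 : 2⁻¹ ^ (2 * n + 1) ≤ x) (h2 : x ≤ 2 * 2⁻¹ ^ (2 * n + 1))
    (h1' : 3 / 4 * 2⁻¹ ^ (2 * n' + 1) < x) (h2' : x < 3 * 2⁻¹ ^ (2 * n' + 1)) : n' = n := by
  have key : ∀ {k l : ℕ}, k < l → (4 : ℝ) * 2⁻¹ ^ (2 * l + 1) ≤ 2⁻¹ ^ (2 * k + 1) := by
    intro k l h
    have : (4 : ℝ) * 2⁻¹ ^ (2 * (k + 1) + 1) = 2⁻¹ ^ (2 * k + 1) := by ring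
    rw [← this]
    exact mul_le_mul_of_nonneg_left (pow_le_pow_of_le_one (by norm_num) (by norm_num) (by omega))
      (by norm_num)
  rcases lt_trichotomy n' n with h | h | h
  · linarith [key h]
  · exact h
  · linarith [key h]

theorem abs_clampRat_sub_le {q : ℚ} {y : ℝ} (hy : y ∈ Icc (0 : ℝ) 1) :
    |(clampRat q : ℝ) - y| ≤ |(q : ℝ) - y| := by
  obtain ⟨h0, h1⟩ := hy
  rw [clampRat]
  split_ifs with h h'
  · have : (q : ℝ) < 0 := by exact_mod_cast h
    rw [Rat.cast_zero, abs_of_nonpos (by linarith), abs_of_nonpos (by linarith)]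
    linarith
  · have : (1 : ℝ) < q := by exact_mod_cast h'
    rw [Rat.cast_one, abs_of_nonneg (by linarith), abs_of_nonneg (by linarith)]
    linarith
  · exact le_rfl

theorem mem_rep_unitInterval {p : ℕ → ℕ} {x : unitInterval} :
    x ∈ RepresentedSpace.rep (X := unitInterval) p ↔
      ∀ n, |(clampRat (ratNum (p n)) : ℝ) - x| ≤ 2⁻¹ ^ n := by
  refine (mem_cauchyRep p x).trans (forall_congr' fun n => ?_)
  rw [Subtype.dist_eq, Real.dist_eq, coe_pt_unitInterval]

/-- From a name of a point of `[L, 2 L]`, `L = 2 ^ (- 2 n - 1)`, one can compute `n` and the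
preimage of the point under `y ↦ L (1 + y)`. -/
theorem exists_decode_functional : ∃ H : (ℕ → ℕ) →. (ℕ → ℕ), ComputableFunctional H ∧
    ∀ (n : ℕ) (x y : unitInterval), (x : ℝ) = 2⁻¹ ^ (2 * n + 1) * (1 + y) →
      ∀ r, x ∈ RepresentedSpace.rep (X := unitInterval) r →
        ∃ s ∈ H r, s 0 = n ∧ y ∈ RepresentedSpace.rep (X := unitInterval) fun i => s (i + 1) := by
  obtain ⟨d, hd, hd'⟩ : PrimrecRat fun a : ℕ × ℕ =>
      clampRat (ratNum a.2) * (2 ^ (2 * a.1 + 1) : ℕ) - 1 :=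
    .sub (.mul (PrimrecRat.clampRat (.ratNum Primrec.snd))
      (.natCast (primrec_two_pow (Primrec.nat_double_succ.comp Primrec.fst)))) (.const 1)
  obtain ⟨H, hH, hH'⟩ := exists_computableFunctional (primrec_decodeDigits hd)
  refine ⟨H, hH, fun n x y hxy r hr => ?_⟩
  rw [mem_rep_unitInterval] at hr
  have hL0 : (0 : ℝ) < 2⁻¹ ^ (2 * n + 1) := by positivity
  have hx1 : 2⁻¹ ^ (2 * n + 1) ≤ (x : ℝ) := by
    rw [hxy]
    exact le_mul_of_one_le_right hL0.le (by linarith [y.2.1])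
  have hx2 : (x : ℝ) ≤ 2 * 2⁻¹ ^ (2 * n + 1) := by
    rw [hxy, mul_comm]
    exact mul_le_mul_of_nonneg_right (by linarith [y.2.2]) hL0.le
  have hfound : ∀ i, ∃ t a, decodeDigits d (initSeg r t) i = some a := by
    intro i
    -- The summand `4` makes the error at most `L/16`, enough for the strict test; the summand `i`
    -- makes the prefix long enough to contain the entry needed for digit `i`.
    set m := i + (2 * n + 1) + 4 with hm
    have hmt : m < Nat.pair m n + 1 := Nat.lt_succ_of_le (Nat.left_le_pair _ _)
    have hpow : (2⁻¹ : ℝ) ^ m * 16 ≤ 2⁻¹ ^ (2 * n + 1) := by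
      have h1 : (2⁻¹ : ℝ) ^ m * 16 = 2⁻¹ ^ i * 2⁻¹ ^ (2 * n + 1) := by rw [hm]; ring
      rw [h1]
      exact mul_le_of_le_one_left hL0.le (pow_le_one₀ (by norm_num) (by norm_num))
    obtain ⟨h1, h2⟩ := abs_le.1 (hr m)
    have hc : 3 / 4 * 2⁻¹ ^ (2 * n + 1) < clampRat (ratNum (r m)) - 2⁻¹ ^ m ∧
        clampRat (ratNum (r m)) + 2⁻¹ ^ m < 3 * 2⁻¹ ^ (2 * n + 1) := by
      rw [← Rat.cast_lt (K := ℝ), ← Rat.cast_lt (K := ℝ)]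
      push_cast
      constructor <;> linarith
    refine ⟨Nat.pair m n + 1, ?_⟩
    simp only [decodeDigits, length_initSeg, Nat.add_sub_cancel, Nat.unpair_pair,
      getD_initSeg hmt, if_pos hc]
    rcases i with _ | i
    · exact ⟨n, rfl⟩
    · have hi : i + (2 * n + 1) < Nat.pair m n + 1 := by omega
      exact ⟨d (n, r (i + (2 * n + 1))), by simp only [getElem?_initSeg hi, Option.map_some]⟩
  obtain ⟨s, hs, hs'⟩ := hH' r hfound
  have hdig : ∀ i, Nat.casesOn (motive := fun _ => Prop) i (s 0 = n)
      fun i => s (i + 1) = d (n, r (i + (2 * n + 1))) := by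
    intro i
    obtain ⟨t, ht⟩ := hs' i
    obtain ⟨w, rfl⟩ : ∃ w, t = w + 1 := by
      refine Nat.exists_eq_succ_of_ne_zero ?_
      rintro rfl
      -- On the empty prefix the default entry codes `0` and the precision is `1`, so the test
      -- fails.
      rw [decodeDigits, ite_eq_iff] at ht
      norm_num [initSeg, clampRat, ratNum] at ht
      exact Option.some_ne_none _ ht.symm
    obtain ⟨m, n', rfl⟩ : ∃ m n', w = Nat.pair m n' := ⟨w.unpair.1, w.unpair.2, by simp⟩
    have hmt : m < Nat.pair m n' + 1 := Nat.lt_succ_of_le (Nat.left_le_pair _ _)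
    simp only [decodeDigits, length_initSeg, Nat.add_sub_cancel, Nat.unpair_pair,
      getD_initSeg hmt] at ht
    rw [ite_eq_iff] at ht
    simp only [reduceCtorEq, and_false, or_false] at ht
    obtain ⟨hc, ht⟩ := ht
    rw [← Rat.cast_lt (K := ℝ), ← Rat.cast_lt (K := ℝ)] at hc
    push_cast at hc
    obtain ⟨h1, h2⟩ := abs_le.1 (hr m)
    obtain rfl : n' = n := eq_of_pow_lt hx1 hx2 (by linarith) (by linarith)
    rcases i with _ | i
    · exact (Option.some_injective _ ht).symm
    · simp only [Option.map_eq_some_iff] at ht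
      obtain ⟨a, ha, hac⟩ := ht
      have hk : i + (2 * n' + 1) < Nat.pair m n' + 1 := by
        by_contra hk
        rw [List.getElem?_eq_none (by simpa using hk)] at ha
        simp at ha
      rw [getElem?_initSeg hk, Option.some_inj] at ha
      change s (i + 1) = _
      rw [← hac, ← ha]
  refine ⟨s, hs, hdig 0, mem_rep_unitInterval.2 fun i => ?_⟩
  have hi : s (i + 1) = d (n, r (i + (2 * n + 1))) := hdig (i + 1)
  rw [hi, hd']
  refine (abs_clampRat_sub_le y.2).trans ?_
  -- Inverting the affine map multiplies errors by `2 ^ (2 * n + 1)`, whence the shift of the index.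
  have h1 := hr (i + (2 * n + 1))
  have h2 : ((2 ^ (2 * n + 1) : ℕ) : ℝ) * 2⁻¹ ^ (2 * n + 1) = 1 := by
    push_cast
    rw [← mul_pow]
    norm_num
  have h3 : ((clampRat (ratNum (r (i + (2 * n + 1)))) * (2 ^ (2 * n + 1) : ℕ) - 1 : ℚ) : ℝ) - y =
      (2 ^ (2 * n + 1) : ℕ) * (clampRat (ratNum (r (i + (2 * n + 1)))) - x) := by
    rw [hxy, mul_sub, ← mul_assoc, h2]
    push_cast
    ring
  dsimp only
  rw [h3, abs_mul, Nat.abs_cast]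
  calc _ ≤ ((2 ^ (2 * n + 1) : ℕ) : ℝ) * 2⁻¹ ^ (i + (2 * n + 1)) := by gcongr
    _ = 2⁻¹ ^ i := by rw [pow_add (2⁻¹ : ℝ), mul_left_comm, h2, mul_one]

theorem starWWKL_strongReducible_ACT : StrongReducible starWWKL ACT := by
  obtain ⟨K, hK, hK'⟩ := exists_coverSeq_functional
  obtain ⟨H, hH, hH'⟩ := exists_decode_functional
  refine .of_functionals hK hH fun a ha p hp => ?_
  obtain ⟨A, hA, rfl⟩ := (Part.mem_map_iff _).1 hp
  obtain rfl := Part.mem_some_iff.1 hA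
  obtain ⟨_, x, ⟨hvol, -⟩, -⟩ := ha
  obtain ⟨q, hq, hq'⟩ := hK' p
  refine ⟨q, hq, _, hq', coverSeq_mem_ACT_dom hvol, fun x hx r hr => ?_⟩
  obtain ⟨y, hxy, hy⟩ := exists_of_not_mem_coverSeq hx.2
  obtain ⟨s, hs, hs0, hys⟩ := hH' _ x y hxy r hr
  exact ⟨s, hs, _, Part.mem_map _ hys, by rw [hs0]; exact ⟨y, ⟨hvol, hy⟩, rfl⟩⟩

end Weihrauch

theorem mainTheorem2 : Weihrauch.StrongEquivalent Weihrauch.ACT Weihrauch.starWWKL :=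
  ⟨Weihrauch.ACT_strongReducible_starWWKL, Weihrauch.starWWKL_strongReducible_ACT⟩
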